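/- **Theorem 1 (GARCH(1,1) prediction density).** Let $\omega,\alpha,\beta>0$, $\lambda\ge 0$, and let $x_t=\sigma_t\varepsilon_t$ $(t\ge 1)$ with $\sigma_t>0$ and $$\sigma_t^2=\omega+(\alpha+\lambda 1_{x_{t-1}<0})\,x_{t-1}^2+\beta\sigma_{t-1}^2\qquad(t\ge 1),$$ where $\varepsilon_1,\varepsilon_2,\dots$ are i.i.d. $N(0,1)$ and independent of the information set $\mathcal F_0$ at time $0$, and $x_0,\sigma_0$ are $\mathcal F_0$-measurable (hence so is $\sigma_1^2$). Put $\theta:=\omega/(2\sigma_1^2)$ and $\underline\beta(\theta):=-\theta+\sqrt{\theta^2+2\theta}$. Let $h\ge 2$. If $h\ge 3$, assume $\beta>\underline\beta(\theta)$ almost surely; if $h>3$, assume also $\beta\ge\frac12$. Then, almost surely, the conditional densities given $\mathcal F_0$ of $z_h:=x_h^2$ and of $x_h$ are $$f_{z_h}(w)=(2\pi)^{-h/2}\sum_{j=0}^\infty\frac{(-2)^{-j}}{j!}\,w^{j-\frac12}c_j\quad(w>0),\qquad f_{z_h}(w)=0\quad(w\le 0),$$ $$f_{x_h}(u)=(2\pi)^{-h/2}\sum_{j=0}^\infty\frac{(-2)^{-j}}{j!}\,u^{2j}c_j\quad(u\in\mathbb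 R),\qquad f_{x_h}(u)=f_{z_h}(u^2)|u|\quad(u\ne 0),$$ both series converging absolutely for every such $w$, $u$. Here $c_j=2^{-h+1}\sum_{s\in\{-1,1\}^{h-1}}c_{j,s}>0$ and, with $\alpha_t:=\alpha+\frac\lambda2(1-s_t)$, $$c_{j,s}=\pi^{\frac{h-1}2}(\sigma_1^2\alpha_{h-1})^{-\frac12}(\omega+\beta\sigma_1^2)^{-j}\sum_{k_1=0}^{m_j}\sum_{k_2=0}^{m_j-K_1}\cdots\sum_{k_{h-2}=0}^{m_j-K_{h-3}}\psi_{h-2}\Big(j,\frac{\omega+\beta\sigma_1^2}{2\alpha_1\sigma_1^2}\Big)\,\omega^{K_{h-2}}\beta^{S_{h-2}-(K_{h-2}+j)(h-2)}(\omega+\beta\sigma_1^2)^{-K_{h-2}}\prod_{t=1}^{h-2}\binom{-\frac12-j-K_{t-1}}{k_t}\alpha_t^{-\frac12}\,\psi_t\Big(j,\frac{\beta}{2\alpha_{h-t}}\Big),$$ where $K_t=\sum_{i=1}^t k_i$, $S_t=\sum_{i=1}^t(i-1)k_i$, $\psi_t(j,y)=\Psi(\frac12,1-j-K_t;y)$,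 $$\Psi(a,c;y)=\frac1{\Gamma(a)}\int_0^\infty e^{-yt}t^{a-1}(1+t)^{c-a-1}\,dt,$$ and $m_j:=b_{-1/2-j}$ with $b_r=r$ if $r\in\mathbb N$ and $b_r=\infty$ otherwise. The nested sums are iterated sums ($k_1$ outermost), each of which converges absolutely. For $h=2$ there are no summation indices and $$c_{j,s}=\pi^{\frac12}(\sigma_1^2\alpha_1)^{-\frac12}(\omega+\beta\sigma_1^2)^{-j}\,\Psi\Big(\tfrac12,1-j;\tfrac{\omega+\beta\sigma_1^2}{2\alpha_1\sigma_1^2}\Big).$$ -/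

import Mathlib

open MeasureTheory ProbabilityTheory

noncomputable section

namespace GJR

/-- The news-impact coefficient `α_t = α + lam * 1_{x_t < 0}` as a function of the value of `x_t`. -/
def alphaOf (α lam x : ℝ) : ℝ := α + lam * (if x < 0 then 1 else 0)

/-- Gaussian GJR-GARCH(1,1) process `x` with volatility `σ`, from time `0` on, where `F₀` is the
information available at time `0`. It contains `x 0` and `σ 0`, and the innovations `ε 1, ε 2, …`
are i.i.d. standard normal and independent of it (`ε 0` plays no role). Deterministic initial
values are the case where `F₀` is trivial. -/
structure IsGarch {Ω : Type*} (F₀ : MeasurableSpace Ω) {mΩ : MeasurableSpace Ω} (μ : Measure Ω)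
    (ω α β lam : ℝ) (ε x σ : ℕ → Ω → ℝ) : Prop where
  le : F₀ ≤ mΩ
  measurable_eps : ∀ t, Measurable (ε (t + 1))
  law_eps : ∀ t, μ.map (ε (t + 1)) = gaussianReal 0 1
  iIndep_eps : iIndepFun (fun t => ε (t + 1)) μ
  indep_past : Indep F₀
    (MeasurableSpace.comap (fun p t => ε (t + 1) p) (inferInstance : MeasurableSpace (ℕ → ℝ))) μ
  measurable_x_zero : Measurable[F₀] (x 0)
  measurable_sigma_zero : Measurable[F₀] (σ 0)
  sigma_pos : ∀ t p, 0 < σ t p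
  x_eq : ∀ t p, x (t + 1) p = σ (t + 1) p * ε (t + 1) p
  sigma_eq : ∀ t p,
    σ (t + 1) p ^ 2 = ω + alphaOf α lam (x t p) * x t p ^ 2 + β * σ t p ^ 2

/-- `f` is a conditional (prediction) density of the real random variable `X` given `F₀`:
almost surely `f p` is nonnegative and integrable, and for every Borel set `B` the conditional
probability of `X ∈ B` given `F₀` is the integral of `f p` over `B`. -/
structure IsCondDensity {Ω : Type*} (F₀ : MeasurableSpace Ω) {mΩ : MeasurableSpace Ω}
    (μ : Measure Ω) (X : Ω → ℝ) (f : Ω → ℝ → ℝ) : Prop where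
  nonneg : ∀ᵐ p ∂μ, ∀ u, 0 ≤ f p u
  integrable : ∀ᵐ p ∂μ, Integrable (f p)
  condProb : ∀ B : Set ℝ, MeasurableSet B →
    μ[(X ⁻¹' B).indicator (fun _ => (1 : ℝ)) | F₀] =ᵐ[μ] fun p => ∫ u in B, f p u

/-- Tricomi's confluent hypergeometric function of the second kind, for real `a, z > 0`. -/
def tricomi (a c z : ℝ) : ℝ :=
  1 / Real.Gamma a *
    ∫ t in Set.Ioi (0 : ℝ), Real.exp (-z * t) * t ^ (a - 1) * (1 + t) ^ (c - a - 1)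

/-- `b_r`: equal to `r` if `r` is a natural number, and to `∞` otherwise. -/
def upper (r : ℝ) : ℕ∞ := if ((⌊r⌋₊ : ℕ) : ℝ) = r then ((⌊r⌋₊ : ℕ) : ℕ∞) else ⊤

/-- The nested sum `∑_{k₁=0}^{m} ∑_{k₂=0}^{m-k₁} ⋯ ∑_{kₙ=0}^{m-k₁-⋯-kₙ₋₁} f (k₁,…,kₙ)`, an
iterated sum with `k₁` outermost. -/
def nestedSum : (n : ℕ) → ℕ∞ → ((Fin n → ℕ) → ℝ) → ℝ
  | 0, _, f => f Fin.elim0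
  | n + 1, m, f => ∑' k : ℕ,
      if (k : ℕ∞) ≤ m then nestedSum n (m - k) (fun l => f (Fin.cons k l)) else 0

/-- Each of the sums that make up `nestedSum n m f` converges absolutely. -/
def NestedSummable : (n : ℕ) → ℕ∞ → ((Fin n → ℕ) → ℝ) → Prop
  | 0, _, _ => True
  | n + 1, m, f =>
      (∀ k : ℕ, (k : ℕ∞) ≤ m → NestedSummable n (m - k) (fun l => f (Fin.cons k l))) ∧
      Summable fun k : ℕ =>
        if (k : ℕ∞) ≤ m then nestedSum n (m - k) (fun l => f (Fin.cons k l)) else 0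

/-- `K_t = k₁ + ⋯ + k_t`, where `k_i` is `k ⟨i - 1, _⟩`. -/
def K {n : ℕ} (k : Fin n → ℕ) (t : ℕ) : ℕ := ∑ i : Fin n with i.val < t, k i

/-- `S_t = ∑_{i=1}^t (i - 1) k_i`, where `k_i` is `k ⟨i - 1, _⟩`. -/
def S {n : ℕ} (k : Fin n → ℕ) (t : ℕ) : ℕ := ∑ i : Fin n with i.val < t, i.val * k i

/-- Sign patterns `(s₁, …, s_{h-1})` with entries `±1`. -/
abbrev Signs (h : ℕ) : Type := Finset.Icc 1 (h - 1) → ℤˣ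

/-- `α_t = α + (lam / 2) (1 - s_t)` for `1 ≤ t ≤ h - 1` (and `0` for other `t`, never used). -/
def alphaSign (α lam : ℝ) {h : ℕ} (s : Signs h) (t : ℕ) : ℝ :=
  if ht : t ∈ Finset.Icc 1 (h - 1) then α + lam / 2 * (1 - (((s ⟨t, ht⟩ : ℤˣ) : ℤ) : ℝ)) else 0

/-- `ψ_t(j, u) = Ψ(1/2, 1 - j - K_t; u)`. -/
def psi {n : ℕ} (k : Fin n → ℕ) (t : ℕ) (j u : ℝ) : ℝ := tricomi (1 / 2) (1 - j - K k t) u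

/-- The summand, with index `k = (k₁, …, k_{h-2})`, of the nested sum in `c_{j,s}`; here `v` stands
for `σ₁²`, and the factor number `t` of the product has index `t - 1` in `Fin (h - 2)`. -/
def term (ω α β lam v : ℝ) (h : ℕ) (j : ℝ) (s : Signs h) (k : Fin (h - 2) → ℕ) : ℝ :=
  psi k (h - 2) j ((ω + β * v) / (2 * alphaSign α lam s 1 * v)) *
    (ω ^ K k (h - 2) * β ^ ((S k (h - 2) : ℝ) - (K k (h - 2) + j) * ((h : ℝ) - 2)) *
      (ω + β * v) ^ (-(K k (h - 2) : ℝ))) *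
    ∏ t : Fin (h - 2),
      (Ring.choose (-1 / 2 - j - K k t.val) (k t) *
        alphaSign α lam s (t.val + 1) ^ (-1 / 2 : ℝ) *
        psi k (t.val + 1) j (β / (2 * alphaSign α lam s (h - (t.val + 1)))))

/-- `c_{j,s}`. For `h = 2` there is no summation index, the powers of `ω` and `β` and the product
are trivial, and the nested sum is `ψ_0(j, (ω + β σ₁²) / (2 α₁ σ₁²))`. -/
def coeffSign (ω α β lam v : ℝ) (h : ℕ) (j : ℝ) (s : Signs h) : ℝ :=
  Real.pi ^ (((h : ℝ) - 1) / 2) * (v * alphaSign α lam s (h - 1)) ^ (-1 / 2 : ℝ) *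
    (ω + β * v) ^ (-j) *
    nestedSum (h - 2) (upper (-1 / 2 - j)) (term ω α β lam v h j s)

/-- `c_j = 2^{-h+1} ∑_s c_{j,s}`. -/
def coeff (ω α β lam v : ℝ) (h : ℕ) (j : ℝ) : ℝ :=
  (2 : ℝ) ^ (-(h : ℝ) + 1) * ∑ s : Signs h, coeffSign ω α β lam v h j s

/-- The summand number `j` of the series for the density of `z_h = x_h²`. -/
def termZ (ω α β lam v : ℝ) (h : ℕ) (w : ℝ) (j : ℕ) : ℝ :=
  (-2 : ℝ) ^ (-(j : ℤ)) / (j.factorial : ℝ) * w ^ ((j : ℝ) - 1 / 2) * coeff ω α β lam v h j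

/-- The summand number `j` of the series for the density of `x_h`. -/
def termX (ω α β lam v : ℝ) (h : ℕ) (u : ℝ) (j : ℕ) : ℝ :=
  (-2 : ℝ) ^ (-(j : ℤ)) / (j.factorial : ℝ) * u ^ (2 * j) * coeff ω α β lam v h j

/-- The series for the density of `z_h` (which is carried by the positive half-line). -/
def densityZ (ω α β lam v : ℝ) (h : ℕ) (w : ℝ) : ℝ :=
  if 0 < w then (2 * Real.pi) ^ (-(h : ℝ) / 2) * ∑' j : ℕ, termZ ω α β lam v h w j else 0

/-- The series for the density of `x_h`. -/
def densityX (ω α β lam v : ℝ) (h : ℕ) (u : ℝ) : ℝ :=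
  (2 * Real.pi) ^ (-(h : ℝ) / 2) * ∑' j : ℕ, termX ω α β lam v h u j

/-- The lower bound `-θ + √(θ² + 2θ)` for `β`. -/
def betaLower (θ : ℝ) : ℝ := -θ + √(θ ^ 2 + 2 * θ)

end GJR

end

/-! Since σ_t > 0, the sign of x_t is that of ε_t, and the squared volatility is a Markov chain
σ_{t+1}² = ω + (β + α(ε_t) ε_t²) σ_t² driven by the innovations alone and started at v = σ_1², which
is known at time 0. Given F₀, x_h is thus a Gaussian mixture: its variance w has the law of this
chain after h - 1 steps. Expanding exp(-u²/(2w)) and integrating term by term, which w ≥ ω permits,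
gives a power series in u² whose coefficients are the moments E[w^{-(1/2+j)}] (`hasSum_termX`,
`densityX_eq_integral`).

To compute them, note that the sign of a Gaussian is independent of its square, so the law of w is
the average over sign patterns of the laws of chains with deterministic coefficients
(`volLaw_alphaOf`). For such a chain the last step is peeled off: (ω + (β + a e²) w)^{-r} is
expanded binomially in ω, and independence splits each term into a Gaussian moment times a moment of
the volatility one step earlier (`hasSum_volMoment_succ`). Iteration down to the first step gives
the nested sums (`nestedSum_nestTerm`), and each Gaussian moment is a Tricomi function
(`gaussMoment_eq_tricomi`). The expansion needs ω < β L, where L is the least possible volatility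
before the step; the conditions on β ensure this (`lt_mul_volLower`).

The density of z_h follows by the substitution w = u², and conditioning on F₀ amounts to freezing
σ_1² (`condExp_indicator_of_indep`). -/

namespace GJR

/-! ### The law of the squared volatility and its lower bounds -/

/-- The law of the squared volatility after `n` steps started at `v`, when step number `t` uses the
news-impact coefficient `a t` as a function of the innovation. -/
noncomputable def volLaw (ω β : ℝ) (a : ℕ → ℝ → ℝ) (v : ℝ) : ℕ → Measure ℝ
  | 0 => Measure.dirac v
  | n + 1 => ((volLaw ω β a v n).prod (gaussianReal 0 1)).map
      fun q => ω + (β + a n q.2 * q.2 ^ 2) * q.1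

/-- The smallest value that the squared volatility can take after `n` steps started at `v`. -/
def volLower (ω β v : ℝ) : ℕ → ℝ
  | 0 => v
  | n + 1 => ω + β * volLower ω β v n

section volLaw

variable {ω β v : ℝ} {a : ℕ → ℝ → ℝ}

lemma measurable_volStep (ha : ∀ n, Measurable (a n)) (n : ℕ) :
    Measurable fun q : ℝ × ℝ => ω + (β + a n q.2 * q.2 ^ 2) * q.1 := by
  have := ha n
  fun_prop

lemma isProbabilityMeasure_volLaw (ha : ∀ n, Measurable (a n)) (n : ℕ) :
    IsProbabilityMeasure (volLaw ω β a v n) := by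
  induction n with
  | zero => exact Measure.dirac.isProbabilityMeasure
  | succ n ih => exact Measure.isProbabilityMeasure_map (measurable_volStep ha n).aemeasurable

lemma volLower_pos (hω : 0 < ω) (hβ : 0 < β) (hv : 0 < v) (n : ℕ) : 0 < volLower ω β v n := by
  induction n with
  | zero => exact hv
  | succ n ih => rw [volLower]; positivity

lemma ae_volLower_le (ha : ∀ n, Measurable (a n)) (ha0 : ∀ n e, 0 ≤ a n e) (hω : 0 < ω)
    (hβ : 0 < β) (hv : 0 < v) (n : ℕ) : ∀ᵐ w ∂volLaw ω β a v n, volLower ω β v n ≤ w := by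
  induction n with
  | zero => rw [volLaw, ae_dirac_iff measurableSet_Ici]; exact le_rfl
  | succ n ih =>
    have := isProbabilityMeasure_volLaw (ω := ω) (β := β) (v := v) ha n
    rw [volLaw, ae_map_iff (measurable_volStep ha n).aemeasurable measurableSet_Ici]
    filter_upwards [Measure.quasiMeasurePreserving_fst.ae ih] with q hq
    have h0 := volLower_pos hω hβ hv n
    have h1 : 0 ≤ a n q.2 * q.2 ^ 2 * q.1 := by
      have := ha0 n q.2
      have : 0 ≤ q.1 := h0.le.trans hq
      positivity
    rw [volLower]
    nlinarith [mul_le_mul_of_nonneg_left hq hβ.le]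

/-- A bound free of v and n: it makes every negative moment finite and dominates the series in j. -/
lemma ae_volLaw_ge (ha : ∀ n, Measurable (a n)) (ha0 : ∀ n e, 0 ≤ a n e) (hω : 0 < ω)
    (hβ : 0 < β) (hv : 0 < v) (n : ℕ) : ∀ᵐ w ∂volLaw ω β a v (n + 1), ω ≤ w := by
  filter_upwards [ae_volLower_le ha ha0 hω hβ hv (n + 1)] with w hw
  refine le_trans ?_ hw
  have := volLower_pos hω hβ hv n
  rw [volLower]
  nlinarith [mul_pos hβ this]

lemma volLaw_congr {a' : ℕ → ℝ → ℝ} (n : ℕ) (h : ∀ t < n, a t = a' t) :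
    volLaw ω β a v n = volLaw ω β a' v n := by
  induction n with
  | zero => rfl
  | succ n ih => rw [volLaw, volLaw, ih fun t ht => h t (by omega), h n (by omega)]

end volLaw

/-- The lower bounds for the squared volatility satisfy the condition under which the binomial
expansions converge. -/
lemma lt_mul_volLower {ω β v : ℝ} (hω : 0 < ω) (hβ : 0 < β) (hv : 0 < v)
    (h1 : betaLower (ω / (2 * v)) < β) {N : ℕ} (h2 : 1 < N → 1 / 2 ≤ β) {n : ℕ} (hn : n + 1 ≤ N) :
    ω < β * volLower ω β v (n + 1) := by
  induction n with
  | zero =>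
    set θ := ω / (2 * v) with hθ
    have hθ0 : 0 < θ := by positivity
    have hs : √(θ ^ 2 + 2 * θ) < β + θ := by rw [betaLower] at h1; linarith
    -- Squaring leaves 2θ < β² + 2βθ; multiplied by v, with 2vθ = ω, this is ω < β (ω + β v).
    rw [Real.sqrt_lt' (by positivity)] at hs
    have : ω = 2 * v * θ := by rw [hθ]; field_simp
    simp only [volLower]
    rw [this]
    nlinarith
  | succ n ih =>
    have hi := ih (by omega)
    have hb := h2 (by omega)
    -- The bound at one step pushes the next lower bound above 2ω, after which β ≥ 1/2 suffices.
    have : 2 * ω < volLower ω β v (n + 1 + 1) := by rw [volLower]; linarith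
    nlinarith

/-! ### Binomial series for negative powers -/

section binomial

lemma hasSum_choose_mul_pow {r x : ℝ} (hx : |x| < 1) :
    HasSum (fun k => Ring.choose r k * x ^ k) ((1 + x) ^ r) := by
  have h := (Real.one_add_rpow_hasFPowerSeriesOnBall_zero (a := r)).hasSum (y := x) (by
    rw [← ENNReal.ofReal_one, Metric.eball_ofReal]
    simpa using hx)
  simpa [binomialSeries, FormalMultilinearSeries.coeff_ofScalars, mul_comm] using h

lemma summable_abs_choose_mul_pow {r x : ℝ} (hx : |x| < 1) :
    Summable fun k => |Ring.choose r k| * |x| ^ k := by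
  have h := (hasSum_choose_mul_pow (r := r) hx).summable.abs
  simpa [abs_mul, abs_pow] using h

/-- The negative power of a sum, expanded in the smaller of the two summands. -/
lemma hasSum_choose_rpow {r ω y : ℝ} (hω : 0 < ω) (hy : ω < y) :
    HasSum (fun k : ℕ => Ring.choose (-r) k * ω ^ k * y ^ (-(r + k))) ((ω + y) ^ (-r)) := by
  have hy0 : 0 < y := hω.trans hy
  have h := (hasSum_choose_mul_pow (r := -r) (x := ω / y) (by
    rw [abs_of_pos (by positivity), div_lt_one hy0]; exact hy)).mul_right (y ^ (-r))
  have e : (1 + ω / y) ^ (-r) * y ^ (-r) = (ω + y) ^ (-r) := by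
    rw [← Real.mul_rpow (by positivity) hy0.le, add_mul, one_mul, div_mul_cancel₀ _ hy0.ne',
      add_comm]
  rw [e] at h
  refine h.congr_fun fun k => ?_
  rw [neg_add, Real.rpow_add hy0, Real.rpow_neg hy0.le (k : ℝ), Real.rpow_natCast, div_pow]
  ring

end binomial

/-! ### Negative moments with deterministic coefficients -/

/-- The expectation of `(A + b e²)^(-ρ)` for a standard normal `e`. -/
noncomputable def gaussMoment (A b ρ : ℝ) : ℝ := ∫ e, (A + b * e ^ 2) ^ (-ρ) ∂gaussianReal 0 1

/-- The moment of order `-r` of the squared volatility. -/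
noncomputable def volMoment (ω β : ℝ) (a : ℕ → ℝ) (v : ℝ) (n : ℕ) (r : ℝ) : ℝ :=
  ∫ w, w ^ (-r) ∂volLaw ω β (fun t _ => a t) v n

section moments

variable {ω β v : ℝ} {a : ℕ → ℝ}

/-- The start is deterministic, so ω + β v is one constant and the first step needs no expansion;
hence n + 1 steps produce only n summation indices. -/
lemma volMoment_one (r : ℝ) :
    volMoment ω β a v 1 r = gaussMoment (ω + β * v) (a 0 * v) r := by
  have hm : ∀ n, Measurable ((fun t _ => a t : ℕ → ℝ → ℝ) n) := fun n => measurable_const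
  rw [volMoment, volLaw, integral_map (measurable_volStep hm 0).aemeasurable
    (by fun_prop : Measurable fun w : ℝ => w ^ (-r)).aestronglyMeasurable, volLaw,
    Measure.dirac_prod, integral_map (by fun_prop)
    (by fun_prop : Measurable fun q : ℝ × ℝ => (ω + (β + a 0 * q.2 ^ 2) * q.1) ^ (-r)).aestronglyMeasurable,
    gaussMoment]
  congr 1 with e
  congr 1
  ring

/-- Peeling off the last step of the squared volatility. -/
lemma hasSum_volMoment_succ (ha0 : ∀ n, 0 ≤ a n) (hω : 0 < ω) (hβ : 0 < β) (hv : 0 < v) {n : ℕ}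
    (hn : ω < β * volLower ω β v n) {r : ℝ} (hr : 0 < r) :
    HasSum (fun k : ℕ => Ring.choose (-r) k * ω ^ k * gaussMoment β (a n) (r + k) *
      volMoment ω β a v n (r + k)) (volMoment ω β a v (n + 1) r) := by
  have hm : ∀ n, Measurable ((fun t _ => a t : ℕ → ℝ → ℝ) n) := fun n => measurable_const
  have hprob := isProbabilityMeasure_volLaw (ω := ω) (β := β) (v := v) hm n
  set ν := volLaw ω β (fun t _ => a t) v n with hν
  set L := volLower ω β v n with hL
  have hL0 : 0 < L := volLower_pos hω hβ hv n
  have hae : ∀ᵐ q ∂ν.prod (gaussianReal 0 1), L ≤ q.1 :=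
    Measure.quasiMeasurePreserving_fst.ae
      (ae_volLower_le hm (fun n _ => ha0 n) hω hβ hv n)
  have hle : ∀ q : ℝ × ℝ, L ≤ q.1 → β * L ≤ (β + a n * q.2 ^ 2) * q.1 := by
    intro q hq
    have := ha0 n
    have h1 : 0 ≤ a n * q.2 ^ 2 * q.1 := mul_nonneg (by positivity) (hL0.le.trans hq)
    nlinarith [mul_le_mul_of_nonneg_left hq hβ.le]
  have hβL : 0 < β * L := by positivity
  have key : HasSum
      (fun k : ℕ => ∫ q, Ring.choose (-r) k * ω ^ k * ((β + a n * q.2 ^ 2) * q.1) ^ (-(r + k))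
        ∂ν.prod (gaussianReal 0 1))
      (∫ q, (ω + (β + a n * q.2 ^ 2) * q.1) ^ (-r) ∂ν.prod (gaussianReal 0 1)) := by
    -- Negative powers decrease, so each term is largest at the smallest base β L, where the series
    -- still converges absolutely.
    have hx : |ω / (β * L)| < 1 := by
      rw [abs_of_pos (by positivity), div_lt_one hβL]; exact hn
    have hs := (summable_abs_choose_mul_pow (r := -r) hx).mul_right ((β * L) ^ (-r))
    refine hasSum_integral_of_dominated_convergence
      (fun k _ => |Ring.choose (-r) k| * |ω / (β * L)| ^ k * (β * L) ^ (-r)) ?_ ?_ ?_ ?_ ?_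
    · intro k
      exact (by fun_prop : Measurable fun q : ℝ × ℝ =>
        Ring.choose (-r) k * ω ^ k * ((β + a n * q.2 ^ 2) * q.1) ^ (-(r + k))).aestronglyMeasurable
    · intro k
      filter_upwards [hae] with q hq
      have h1 := hle q hq
      have h2 : ((β + a n * q.2 ^ 2) * q.1) ^ (-(r + k)) ≤ (β * L) ^ (-(r + k)) :=
        Real.rpow_le_rpow_of_nonpos hβL h1 (by have : (0:ℝ) ≤ k := k.cast_nonneg; linarith)
      have h3 : 0 ≤ ((β + a n * q.2 ^ 2) * q.1) ^ (-(r + k)) :=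
        Real.rpow_nonneg (hβL.le.trans h1) _
      rw [Real.norm_eq_abs, abs_mul, abs_mul, abs_of_nonneg h3, abs_pow, abs_of_pos hω,
        abs_of_pos (by positivity : 0 < ω / (β * L)), mul_assoc, mul_assoc]
      refine mul_le_mul_of_nonneg_left ?_ (abs_nonneg _)
      refine (mul_le_mul_of_nonneg_left h2 (by positivity)).trans_eq ?_
      rw [neg_add, Real.rpow_add hβL, Real.rpow_neg hβL.le (k : ℝ), Real.rpow_natCast, div_pow]
      ring
    · exact ae_of_all _ fun _ => hs
    · exact integrable_const _
    · filter_upwards [hae] with q hq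
      exact hasSum_choose_rpow hω (hn.trans_le (hle q hq))
  rw [volMoment, volLaw, integral_map (measurable_volStep hm n).aemeasurable
    (by fun_prop : Measurable fun w : ℝ => w ^ (-r)).aestronglyMeasurable]
  convert key using 1
  ext k
  rw [integral_const_mul, mul_assoc]
  congr 1
  -- The innovation is independent of the volatility before it, so the integral of the power of the
  -- product factors.
  rw [volMoment, gaussMoment, mul_comm, ← integral_prod_mul]
  refine integral_congr_ae ?_
  filter_upwards [hae] with q hq
  have := ha0 n
  rw [Real.mul_rpow (by positivity) (hL0.le.trans hq), mul_comm]

end moments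

/-- Gaussian moments of `A + b e²` in terms of Tricomi's function. -/
lemma gaussMoment_eq_tricomi {A b : ℝ} (hA : 0 < A) (hb : 0 < b) (ρ : ℝ) :
    gaussMoment A b ρ = (2 * Real.pi) ^ (-1 / 2 : ℝ) * Real.pi ^ (1 / 2 : ℝ) *
      (A ^ (1 / 2 - ρ) * b ^ (-1 / 2 : ℝ) * tricomi (1 / 2) (3 / 2 - ρ) (A / (2 * b))) := by
  set C : ℝ := (2 * Real.pi) ^ (-1 / 2 : ℝ) with hC
  have hpdf : ∀ e : ℝ, gaussianPDFReal 0 1 e = C * Real.exp (-(e ^ 2 / 2)) := by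
    intro e
    rw [gaussianPDFReal, hC, Real.sqrt_eq_rpow, ← Real.rpow_neg (by positivity)]
    norm_num
    ring_nf
    simp
  set g : ℝ → ℝ := fun y =>
    C / 2 * (Real.exp (-(y / 2)) * y ^ (-1 / 2 : ℝ) * (A + b * y) ^ (-ρ)) with hg
  -- The integrand is even in e: it folds onto the half-line, where y = e² turns it into `g`.
  have h1 : gaussMoment A b ρ = 2 * ∫ y in Set.Ioi (0 : ℝ), g y := by
    rw [gaussMoment, integral_gaussianReal_eq_integral_smul one_ne_zero]
    have e1 : ∀ e : ℝ, gaussianPDFReal 0 1 e • (A + b * e ^ 2) ^ (-ρ) =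
        (fun x => C * Real.exp (-(x ^ 2 / 2)) * (A + b * x ^ 2) ^ (-ρ)) |e| := by
      intro e
      simp only [hpdf, sq_abs, smul_eq_mul]
    simp_rw [e1]
    rw [integral_comp_abs (f := fun x => C * Real.exp (-(x ^ 2 / 2)) * (A + b * x ^ 2) ^ (-ρ)),
      ← integral_comp_rpow_Ioi_of_pos (g := g) (zero_lt_two)]
    congr 1
    refine setIntegral_congr_fun measurableSet_Ioi fun x hx => ?_
    have hx : 0 < x := hx
    have e2 : (x ^ (2 : ℝ)) ^ (-1 / 2 : ℝ) = x⁻¹ := by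
      rw [← Real.rpow_mul hx.le]; norm_num [Real.rpow_neg_one]
    simp only [hg, smul_eq_mul, e2]
    norm_num
    field_simp
  -- With y = (A / b) t one has A + b y = A (1 + t), which leads to Tricomi's integrand.
  have h2 := integral_comp_mul_left_Ioi g 0 (div_pos hA hb)
  rw [mul_zero, smul_eq_mul] at h2
  have h3 : ∫ y in Set.Ioi (0 : ℝ), g y = A / b * ∫ x in Set.Ioi (0 : ℝ), g (A / b * x) := by
    rw [h2]; field_simp
  have h4 : ∫ x in Set.Ioi (0 : ℝ), g (A / b * x) =
      C / 2 * (A / b) ^ (-1 / 2 : ℝ) * A ^ (-ρ) * ∫ t in Set.Ioi (0 : ℝ),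
        Real.exp (-(A / (2 * b)) * t) * t ^ ((1 / 2 : ℝ) - 1) *
          (1 + t) ^ ((3 / 2 - ρ) - 1 / 2 - 1) := by
    rw [← integral_const_mul]
    refine setIntegral_congr_fun measurableSet_Ioi fun x hx => ?_
    have hx : 0 < x := hx
    have e1 : A + b * (A / b * x) = A * (1 + x) := by field_simp
    have e2 : (3 / 2 - ρ) - 1 / 2 - 1 = -ρ := by ring
    have e3 : (1 / 2 : ℝ) - 1 = -1 / 2 := by norm_num
    have e4 : -(A / b * x / 2) = -(A / (2 * b)) * x := by field_simp
    simp only [hg]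
    rw [e1, e2, e3, e4, Real.mul_rpow (by positivity) hx.le, Real.mul_rpow hA.le (by positivity)]
    ring
  rw [h1, h3, h4, tricomi, Real.Gamma_one_half_eq, Real.sqrt_eq_rpow, Real.div_rpow hA.le hb.le,
    sub_eq_add_neg (1 / 2 : ℝ) ρ, Real.rpow_add hA]
  have f1 : A ^ (-1 / 2 : ℝ) * A = A ^ (1 / 2 : ℝ) := by
    rw [← Real.rpow_add_one hA.ne']; norm_num
  have f2 : b ^ (-1 / 2 : ℝ) * b ^ (-1 / 2 : ℝ) * b = 1 := by
    rw [← Real.rpow_add hb, ← Real.rpow_add_one hb.ne']; norm_num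
  have f3 : b ^ (-1 / 2 : ℝ) ≠ 0 := (Real.rpow_pos_of_pos hb _).ne'
  have f4 : Real.pi ^ (1 / 2 : ℝ) ≠ 0 := (Real.rpow_pos_of_pos Real.pi_pos _).ne'
  rw [← f1]
  generalize (∫ t in Set.Ioi (0 : ℝ), Real.exp (-(A / (2 * b)) * t) * t ^ ((1 / 2 : ℝ) - 1) *
          (1 + t) ^ ((3 / 2 - ρ) - 1 / 2 - 1)) = I
  generalize b ^ (-1 / 2 : ℝ) = B at *
  field_simp
  linear_combination (-C * I) * f2

/-! ### Nested sums and the coefficients c_{j,s} -/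

section indices

variable {n : ℕ}

lemma K_zero (k : Fin n → ℕ) : K k 0 = 0 := by simp [K]

lemma K_cons (k₀ : ℕ) (k : Fin n → ℕ) (t : ℕ) :
    K (Fin.cons k₀ k : Fin (n + 1) → ℕ) (t + 1) = k₀ + K k t := by
  simp [K, Finset.sum_filter, Fin.sum_univ_succ]

lemma S_cons (k₀ : ℕ) (k : Fin n → ℕ) (t : ℕ) :
    S (Fin.cons k₀ k : Fin (n + 1) → ℕ) (t + 1) = S k t + K k t := by
  simp [K, S, Finset.sum_filter, Fin.sum_univ_succ, add_mul, ← Finset.sum_add_distrib]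
  refine Finset.sum_congr rfl fun i _ => ?_
  split_ifs <;> simp

lemma K_self (k : Fin n → ℕ) : K k n = ∑ i, k i := by
  simp [K]

/-- Summation by parts for the partial sums `K_t`. -/
lemma sum_K_add_S (k : Fin n → ℕ) : ∑ t : Fin n, K k (t + 1) + S k n = n * K k n := by
  induction n with
  | zero => simp [S]
  | succ n ih =>
    obtain ⟨k₀, k, rfl⟩ : ∃ k₀ k', k = Fin.cons k₀ k' := ⟨k 0, Fin.tail k, (Fin.cons_self_tail k).symm⟩
    have h2 : ∑ t : Fin n, K k (t : ℕ).succ = ∑ t : Fin n, K k (t + 1) := rfl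
    simp only [K_cons, S_cons, Fin.sum_univ_succ, Fin.val_zero, Fin.val_succ, K_zero,
      Finset.sum_add_distrib, Finset.sum_const, Finset.card_univ, Fintype.card_fin, smul_eq_mul]
    linarith [ih k]

lemma nestedSum_const_mul (c : ℝ) (m : ℕ∞) (f : (Fin n → ℕ) → ℝ) :
    nestedSum n m (fun k => c * f k) = c * nestedSum n m f := by
  induction n generalizing m with
  | zero => rfl
  | succ n ih =>
    simp only [nestedSum, ih, ← tsum_mul_left, mul_ite, mul_zero]

lemma NestedSummable.const_mul (c : ℝ) {m : ℕ∞} {f : (Fin n → ℕ) → ℝ}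
    (hf : NestedSummable n m f) : NestedSummable n m (fun k => c * f k) := by
  induction n generalizing m with
  | zero => trivial
  | succ n ih =>
    refine ⟨fun k hk => ih (hf.1 k hk), ?_⟩
    simpa only [nestedSum_const_mul, mul_ite, mul_zero] using hf.2.mul_left c

end indices

/-- The summand of the iterated binomial expansion of `volMoment` of `n + 1` steps. -/
noncomputable def nestTerm (ω β : ℝ) (a : ℕ → ℝ) (v : ℝ) (n : ℕ) (r : ℝ) (k : Fin n → ℕ) : ℝ :=
  (∏ t : Fin n, Ring.choose (-r - K k t) (k t) * ω ^ k t *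
    gaussMoment β (a (n - t)) (r + K k (t + 1))) * volMoment ω β a v 1 (r + K k n)

section nest

variable {ω β v : ℝ} {a : ℕ → ℝ}

/-- The outermost index belongs to the last step and raises the order from r to r + k₀, exactly as
in `hasSum_volMoment_succ`. -/
lemma nestTerm_cons (n : ℕ) (r : ℝ) (k₀ : ℕ) (k : Fin n → ℕ) :
    nestTerm ω β a v (n + 1) r (Fin.cons k₀ k) =
      Ring.choose (-r) k₀ * ω ^ k₀ * gaussMoment β (a (n + 1)) (r + k₀) *
        nestTerm ω β a v n (r + k₀) k := by
  simp only [nestTerm, Fin.prod_univ_succ, K_cons, Fin.val_zero, Fin.val_succ, K_zero,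
    Fin.cons_zero, Fin.cons_succ, Nat.add_sub_add_right, Nat.cast_add, Nat.cast_zero, sub_zero,
    Nat.sub_zero, add_zero, ← add_assoc, ← sub_sub, neg_add, mul_assoc]
  simp only [← sub_eq_add_neg]

/-- Induction on n with r general: the inner sums are moments of order -(r + k) by hypothesis, and
`hasSum_volMoment_succ` sums them over the outermost k. -/
theorem nestedSum_nestTerm (ha0 : ∀ n, 0 ≤ a n) (hω : 0 < ω) (hβ : 0 < β) (hv : 0 < v) {n : ℕ}
    (hn : ∀ m, m < n → ω < β * volLower ω β v (m + 1)) {r : ℝ} (hr : 0 < r) :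
    NestedSummable n ⊤ (nestTerm ω β a v n r) ∧
      nestedSum n ⊤ (nestTerm ω β a v n r) = volMoment ω β a v (n + 1) r := by
  induction n generalizing r with
  | zero => exact ⟨trivial, by simp [nestedSum, nestTerm, K_self]⟩
  | succ n ih =>
    have ih' := fun k : ℕ => ih (r := r + k) (fun m hm => hn m (by omega)) (by positivity)
    have hs := hasSum_volMoment_succ ha0 hω hβ hv (hn n (by omega)) hr
    have ht : ∀ k : ℕ, (⊤ : ℕ∞) - k = ⊤ := fun k => by simp
    have e : ∀ k : ℕ, nestedSum n ⊤ (fun l => nestTerm ω β a v (n + 1) r (Fin.cons k l)) =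
        Ring.choose (-r) k * ω ^ k * gaussMoment β (a (n + 1)) (r + k) *
          volMoment ω β a v (n + 1) (r + k) := by
      intro k
      simp only [nestTerm_cons, nestedSum_const_mul, (ih' k).2]
    refine ⟨⟨fun k _ => ?_, ?_⟩, ?_⟩
    · rw [ht]
      simp only [nestTerm_cons]
      exact (ih' k).1.const_mul _
    · simp only [ht, le_top, if_true, e]
      exact hs.summable
    · simp only [nestedSum, ht, le_top, if_true, e]
      exact hs.tsum_eq

end nest

/-- Used at -1/2 - j with j ≥ 0: every m_j is infinite, so the nested sums are full series. -/
lemma upper_of_neg {r : ℝ} (hr : r < 0) : upper r = ⊤ := by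
  rw [upper, Nat.floor_of_nonpos hr.le, if_neg (by simpa using hr.ne')]

lemma alphaSign_pos {α lam : ℝ} (hα : 0 < α) (hlam : 0 ≤ lam) {n : ℕ} (s : Signs (n + 2)) {t : ℕ}
    (ht : t < n + 1) : 0 < alphaSign α lam s (t + 1) := by
  rw [alphaSign, dif_pos (by simp; omega)]
  rcases Int.units_eq_one_or (s ⟨t + 1, by simp; omega⟩) with h | h <;> rw [h] <;> simp <;> linarith

lemma alphaSign_nonneg {α lam : ℝ} (hα : 0 < α) (hlam : 0 ≤ lam) {n : ℕ} (s : Signs (n + 2))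
    (t : ℕ) : 0 ≤ alphaSign α lam s (t + 1) := by
  by_cases ht : t < n + 1
  · exact (alphaSign_pos hα hlam s ht).le
  · rw [alphaSign, dif_neg (by simp; omega)]

lemma nestTerm_eq {ω α β lam v : ℝ} (hω : 0 < ω) (hα : 0 < α) (hβ : 0 < β) (hlam : 0 ≤ lam)
    (hv : 0 < v) (n : ℕ) (j : ℝ) (s : Signs (n + 2)) (k : Fin n → ℕ) :
    (2 * Real.pi) ^ (((n : ℝ) + 1) / 2) *
      nestTerm ω β (fun i => alphaSign α lam s (i + 1)) v n (1 / 2 + j) k =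
    Real.pi ^ (((n : ℝ) + 1) / 2) * (v * alphaSign α lam s (n + 1)) ^ (-1 / 2 : ℝ) *
      (ω + β * v) ^ (-j) * term ω α β lam v (n + 2) j s k := by
  set a : ℕ → ℝ := fun i => alphaSign α lam s (i + 1) with ha
  have hpos : ∀ t, t < n + 1 → 0 < a t := fun t ht => alphaSign_pos hα hlam s ht
  have hA : 0 < ω + β * v := by positivity
  obtain ⟨c, hc⟩ : ∃ c : ℝ, c = (2 * Real.pi) ^ (-1 / 2 : ℝ) * Real.pi ^ (1 / 2 : ℝ) := ⟨_, rfl⟩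
  have g1 : ∀ t : Fin n, gaussMoment β (a (n - t)) (1 / 2 + j + K k (t + 1)) =
      c * (β ^ (-j - K k (t + 1)) *
        (a (n - t) ^ (-1 / 2 : ℝ) * psi k (t + 1) j (β / (2 * a (n - t))))) := by
    intro t
    rw [hc, gaussMoment_eq_tricomi hβ (hpos _ (by omega)), psi]
    ring_nf
  have g2 : volMoment ω β a v 1 (1 / 2 + j + K k n) =
      c * ((ω + β * v) ^ (-j - K k n) * (a 0 ^ (-1 / 2 : ℝ) * v ^ (-1 / 2 : ℝ)) *
          psi k n j ((ω + β * v) / (2 * a 0 * v))) := by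
    rw [hc, volMoment_one, gaussMoment_eq_tricomi hA (mul_pos (hpos 0 (by omega)) hv), psi,
      Real.mul_rpow (hpos 0 (by omega)).le hv.le]
    ring_nf
  have p1 : ∏ t : Fin n, ω ^ k t = ω ^ K k n := by
    rw [Finset.prod_pow_eq_pow_sum, K_self]
  -- The exponents of β add up through ∑ K_t = n K_n - S_n.
  have p2 : ∏ t : Fin n, β ^ (-j - K k (t + 1)) = β ^ ((S k n : ℝ) - (K k n + j) * n) := by
    rw [← Real.rpow_sum_of_pos hβ]
    congr 1
    have := congrArg (Nat.cast : ℕ → ℝ) (sum_K_add_S k)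
    push_cast at this
    simp only [Finset.sum_sub_distrib, Finset.sum_const, Finset.card_univ, Fintype.card_fin,
      nsmul_eq_mul]
    linarith
  -- Peeling from the end lists a_n, …, a_1 and leaves a_0 for the first step; the formula for
  -- c_{j,s} lists a_0, …, a_{n-1} and keeps a_n in the prefactor.
  have p3 : (∏ t : Fin n, a (n - t) ^ (-1 / 2 : ℝ)) * a 0 ^ (-1 / 2 : ℝ) =
      (∏ t : Fin n, a t ^ (-1 / 2 : ℝ)) * a n ^ (-1 / 2 : ℝ) := by
    have h := Finset.prod_range_reflect (fun i => a i ^ (-1 / 2 : ℝ)) (n + 1)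
    rw [Finset.prod_range_succ, Finset.prod_range_succ] at h
    rw [Fin.prod_univ_eq_prod_range (fun t => a (n - t) ^ (-1 / 2 : ℝ)),
      Fin.prod_univ_eq_prod_range (fun t => a t ^ (-1 / 2 : ℝ)), ← h]
    simp
  -- Each of the n + 1 Gaussian moments contributes one factor c.
  have p4 : c ^ (n + 1) * (2 * Real.pi) ^ (((n : ℝ) + 1) / 2) = Real.pi ^ (((n : ℝ) + 1) / 2) := by
    have h1 : (0 : ℝ) ≤ 2 * Real.pi := by positivity
    rw [hc, mul_pow, ← Real.rpow_natCast, ← Real.rpow_natCast, ← Real.rpow_mul h1,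
      ← Real.rpow_mul Real.pi_pos.le, mul_right_comm, ← Real.rpow_add (by positivity)]
    push_cast
    rw [show -1 / 2 * ((n : ℝ) + 1) + (n + 1) / 2 = 0 by ring, Real.rpow_zero, one_mul]
    congr 1
    ring
  have q1 : ∀ t : Fin n, alphaSign α lam s (n + 2 - ((t : ℕ) + 1)) = a (n - t) := by
    intro t
    simp only [ha]
    congr 1
    omega
  have q2 : (ω + β * v) ^ (-j - (K k n : ℝ)) =
      (ω + β * v) ^ (-j) * (ω + β * v) ^ (-(K k n : ℝ)) := by
    rw [← Real.rpow_add hA]; rfl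
  have q3 : ∀ t : Fin n, -(1 / 2 + j) - (K k t : ℝ) = -1 / 2 - j - K k t := fun t => by ring
  have q5 : (v * alphaSign α lam s (n + 1)) ^ (-1 / 2 : ℝ) =
      v ^ (-1 / 2 : ℝ) * a n ^ (-1 / 2 : ℝ) := Real.mul_rpow hv.le (hpos n (by omega)).le
  have q4 : ((n + 2 : ℕ) : ℝ) - 2 = n := by push_cast; ring
  have hterm : term ω α β lam v (n + 2) j s k =
      psi k n j ((ω + β * v) / (2 * a 0 * v)) *
        (ω ^ K k n * β ^ ((S k n : ℝ) - (K k n + j) * (((n + 2 : ℕ) : ℝ) - 2)) *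
          (ω + β * v) ^ (-(K k n : ℝ))) *
        ∏ t : Fin n, (Ring.choose (-1 / 2 - j - (K k t : ℝ)) (k t) * a t ^ (-1 / 2 : ℝ) *
          psi k (t + 1) j (β / (2 * alphaSign α lam s (n + 2 - (t + 1))))) := rfl
  rw [nestTerm, hterm]
  simp only [g1, g2, q1, q3, q2, q4, Finset.prod_mul_distrib, p1, p2,
    Finset.prod_const, Finset.card_univ, Fintype.card_fin,
    q5, ← p4]
  rw [pow_succ]
  generalize (∏ t : Fin n, a t ^ (-1 / 2 : ℝ)) = P1 at *
  generalize (∏ t : Fin n, a (n - t) ^ (-1 / 2 : ℝ)) = P2 at *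
  generalize (∏ t : Fin n, psi k (t + 1) j (β / (2 * a (n - t)))) = P3
  generalize (∏ t : Fin n, Ring.choose (-1 / 2 - j - (K k t : ℝ)) (k t)) = P4
  linear_combination (2 * Real.pi) ^ (((n : ℝ) + 1) / 2) * c ^ n * c *
    (ω + β * v) ^ (-j) * (ω + β * v) ^ (-(K k n : ℝ)) * v ^ (-1 / 2 : ℝ) * ω ^ K k n *
    β ^ ((S k n : ℝ) - (K k n + j) * n) * psi k n j ((ω + β * v) / (2 * a 0 * v)) *
    P3 * P4 * p3

/-- The coefficients `c_{j,s}` are, up to a constant, negative moments of the squared volatility. -/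
theorem coeffSign_eq_volMoment {ω α β lam v : ℝ} (hω : 0 < ω) (hα : 0 < α) (hβ : 0 < β)
    (hlam : 0 ≤ lam) (hv : 0 < v) {n : ℕ}
    (hn : ∀ m, m < n → ω < β * volLower ω β v (m + 1)) {j : ℝ} (hj : 0 ≤ j) (s : Signs (n + 2)) :
    NestedSummable n (upper (-1 / 2 - j)) (term ω α β lam v (n + 2) j s) ∧
    coeffSign ω α β lam v (n + 2) j s = (2 * Real.pi) ^ (((n : ℝ) + 1) / 2) *
      volMoment ω β (fun i => alphaSign α lam s (i + 1)) v (n + 1) (1 / 2 + j) := by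
  have hA : 0 < ω + β * v := by positivity
  have hP : 0 < Real.pi ^ (((n : ℝ) + 1) / 2) * (v * alphaSign α lam s (n + 1)) ^ (-1 / 2 : ℝ) *
      (ω + β * v) ^ (-j) := by
    have := alphaSign_pos hα hlam s (t := n) (by omega)
    have := Real.pi_pos
    positivity
  have key := nestTerm_eq hω hα hβ hlam hv n j s
  obtain ⟨h1, h2⟩ := nestedSum_nestTerm (a := fun i => alphaSign α lam s (i + 1))
    (alphaSign_nonneg hα hlam s) hω hβ hv hn (r := 1 / 2 + j) (by positivity)
  have hu : upper (-1 / 2 - j) = ⊤ := upper_of_neg (by linarith)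
  have ht : term ω α β lam v (n + 2) j s = fun k =>
      (Real.pi ^ (((n : ℝ) + 1) / 2) * (v * alphaSign α lam s (n + 1)) ^ (-1 / 2 : ℝ) *
      (ω + β * v) ^ (-j))⁻¹ * (2 * Real.pi) ^ (((n : ℝ) + 1) / 2) *
        nestTerm ω β (fun i => alphaSign α lam s (i + 1)) v n (1 / 2 + j) k := by
    ext k
    rw [mul_assoc, key k, inv_mul_cancel_left₀ hP.ne']
  refine ⟨?_, ?_⟩
  · rw [hu, ht]
    exact h1.const_mul _
  · have q : (((n + 2 : ℕ) : ℝ) - 1) / 2 = ((n : ℝ) + 1) / 2 := by push_cast; ring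
    rw [coeffSign, hu, q]
    change _ * nestedSum n ⊤ (term ω α β lam v (n + 2) j s) = _
    rw [ht, nestedSum_const_mul, h2, mul_assoc _⁻¹]
    exact mul_inv_cancel_left₀ hP.ne' _

open scoped ENNReal

/-! ### Averaging over the signs of the innovations -/

section even

lemma setLIntegral_Iio_gaussianReal {G : ℝ → ℝ≥0∞} (hG : Measurable G) (heven : ∀ e, G (-e) = G e) :
    ∫⁻ e in Set.Iio 0, G e ∂gaussianReal 0 1 = 2⁻¹ * ∫⁻ e, G e ∂gaussianReal 0 1 ∧
    ∫⁻ e in (Set.Iio 0)ᶜ, G e ∂gaussianReal 0 1 = 2⁻¹ * ∫⁻ e, G e ∂gaussianReal 0 1 := by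
  have := nullSingletonClass_gaussianReal (μ := 0) (v := 1) one_ne_zero
  have h1 : ∫⁻ e in Set.Iio 0, G e ∂gaussianReal 0 1 =
      ∫⁻ e in (Set.Iio 0)ᶜ, G e ∂gaussianReal 0 1 := by
    rw [Set.compl_Iio, setLIntegral_congr Ioi_ae_eq_Ici.symm]
    have hneg : (gaussianReal 0 1).map (fun x => -x) = gaussianReal 0 1 := by
      simpa using gaussianReal_map_neg (μ := 0) (v := 1)
    conv_lhs => rw [← hneg]
    rw [setLIntegral_map measurableSet_Iio hG measurable_neg]
    simp only [heven]
    congr 2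
    ext x
    simp
  have h2 := lintegral_add_compl (μ := gaussianReal 0 1) G (measurableSet_Iio (a := (0 : ℝ)))
  rw [h1, ← two_mul] at h2
  have h3 : ∫⁻ e in (Set.Iio 0)ᶜ, G e ∂gaussianReal 0 1 = 2⁻¹ * ∫⁻ e, G e ∂gaussianReal 0 1 := by
    rw [← h2, ← mul_assoc, ENNReal.inv_mul_cancel (by norm_num) (by norm_num), one_mul]
  exact ⟨h1.trans h3, h3⟩

/-- The news-impact coefficient for a given sign of the innovation. -/
noncomputable def alphaUnit (α lam : ℝ) (s : ℤˣ) : ℝ := α + lam / 2 * (1 - ((s : ℤ) : ℝ))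

/-- On each half-line the news-impact coefficient is constant, and what remains is even in e, so the
half-line carries half of the full integral. -/
lemma lintegral_alphaOf (α lam : ℝ) {F : ℝ → ℝ≥0∞} (hF : Measurable F) :
    ∫⁻ e, F (alphaOf α lam e * e ^ 2) ∂gaussianReal 0 1 =
      2⁻¹ * ∑ s : ℤˣ, ∫⁻ e, F (alphaUnit α lam s * e ^ 2) ∂gaussianReal 0 1 := by
  have hm : ∀ s, Measurable fun e => F (alphaUnit α lam s * e ^ 2) := fun s => by fun_prop
  have he : ∀ s (e : ℝ), F (alphaUnit α lam s * (-e) ^ 2) = F (alphaUnit α lam s * e ^ 2) :=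
    fun s e => by rw [neg_sq]
  rw [← lintegral_add_compl _ (measurableSet_Iio (a := (0 : ℝ))), UnitsInt.univ,
    Finset.sum_pair (by decide), mul_add, ← (setLIntegral_Iio_gaussianReal (hm (-1)) (he _)).1,
    ← (setLIntegral_Iio_gaussianReal (hm 1) (he _)).2, add_comm]
  congr 1
  · refine setLIntegral_congr_fun measurableSet_Iio.compl fun e h => ?_
    have : ¬ e < 0 := h
    simp [alphaOf, alphaUnit, this]
  · refine setLIntegral_congr_fun measurableSet_Iio fun e h => ?_
    have : e < 0 := h
    simp only [alphaOf, alphaUnit, this]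
    congr 2
    push_cast
    norm_num

end even

lemma measurable_alphaOf (α lam : ℝ) : Measurable (alphaOf α lam) := by
  unfold alphaOf
  exact measurable_const.add (measurable_const.mul
    (Measurable.ite measurableSet_Iio measurable_const measurable_const))

lemma alphaOf_nonneg {α lam : ℝ} (hα : 0 < α) (hlam : 0 ≤ lam) (e : ℝ) : 0 ≤ alphaOf α lam e := by
  unfold alphaOf
  split_ifs <;> linarith

lemma lintegral_volLaw_succ {ω β v : ℝ} {a : ℕ → ℝ → ℝ} (ha : ∀ n, Measurable (a n)) (n : ℕ)
    {F : ℝ → ℝ≥0∞} (hF : Measurable F) :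
    ∫⁻ w, F w ∂volLaw ω β a v (n + 1) = ∫⁻ w, ∫⁻ e, F (ω + (β + a n e * e ^ 2) * w)
      ∂gaussianReal 0 1 ∂volLaw ω β a v n := by
  have := isProbabilityMeasure_volLaw (ω := ω) (β := β) (v := v) ha n
  rw [volLaw, lintegral_map hF (measurable_volStep ha n), lintegral_prod]
  exact (hF.comp (measurable_volStep ha n)).aemeasurable

/-- The coefficient sequence of a finite sign pattern. -/
noncomputable def alphaSeq (α lam : ℝ) {n : ℕ} (s : Fin n → ℤˣ) (t : ℕ) : ℝ :=
  if ht : t < n then alphaUnit α lam (s ⟨t, ht⟩) else 0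

lemma alphaSeq_snoc_of_lt (α lam : ℝ) {n : ℕ} (s : Fin n → ℤˣ) (u : ℤˣ) {t : ℕ} (ht : t < n) :
    alphaSeq α lam (Fin.snoc s u : Fin (n + 1) → ℤˣ) t = alphaSeq α lam s t := by
  rw [alphaSeq, alphaSeq, dif_pos (by omega), dif_pos ht]
  congr 1
  exact Fin.snoc_castSucc (α := fun _ => ℤˣ) u s ⟨t, ht⟩

lemma alphaSeq_snoc_last (α lam : ℝ) {n : ℕ} (s : Fin n → ℤˣ) (u : ℤˣ) :
    alphaSeq α lam (Fin.snoc s u : Fin (n + 1) → ℤˣ) n = alphaUnit α lam u := by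
  rw [alphaSeq, dif_pos (by omega)]
  congr 1
  exact Fin.snoc_last (α := fun _ => ℤˣ) u s

/-- Averaging the laws of the squared volatility over all sign patterns of the innovations. -/
lemma lintegral_volLaw_alphaOf (ω β α lam v : ℝ) (n : ℕ) {F : ℝ → ℝ≥0∞} (hF : Measurable F) :
    ∫⁻ w, F w ∂volLaw ω β (fun _ => alphaOf α lam) v n =
      2⁻¹ ^ n * ∑ s : Fin n → ℤˣ, ∫⁻ w, F w ∂volLaw ω β (fun t _ => alphaSeq α lam s t) v n := by
  induction n generalizing F with
  | zero => simp [volLaw]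
  | succ n ih =>
    have hG : ∀ u : ℤˣ, Measurable fun w =>
        ∫⁻ e, F (ω + (β + alphaUnit α lam u * e ^ 2) * w) ∂gaussianReal 0 1 := fun u =>
      Measurable.lintegral_prod_right'
        (f := fun q : ℝ × ℝ => F (ω + (β + alphaUnit α lam u * q.2 ^ 2) * q.1)) (by fun_prop)
    rw [lintegral_volLaw_succ (fun _ => measurable_alphaOf α lam) n hF]
    have h1 : ∀ w, ∫⁻ e, F (ω + (β + alphaOf α lam e * e ^ 2) * w) ∂gaussianReal 0 1 =
        2⁻¹ * ∑ u : ℤˣ, ∫⁻ e, F (ω + (β + alphaUnit α lam u * e ^ 2) * w) ∂gaussianReal 0 1 :=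
      fun w => lintegral_alphaOf α lam (F := fun y => F (ω + (β + y) * w)) (by fun_prop)
    simp_rw [h1]
    rw [ih (Finset.measurable_sum _ (fun u _ => hG u) |>.const_mul _),
      ← (Fin.snocEquiv fun _ : Fin (n + 1) => ℤˣ).sum_comp, Fintype.sum_prod_type,
      Finset.sum_comm, pow_succ, mul_assoc]
    congr 1
    rw [Finset.mul_sum]
    refine Finset.sum_congr rfl fun s _ => ?_
    rw [lintegral_const_mul _ (Finset.measurable_sum _ (fun u _ => hG u)),
      lintegral_finsetSum _ (fun u _ => hG u)]
    congr 1
    refine Finset.sum_congr rfl fun u _ => ?_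
    rw [lintegral_volLaw_succ (fun _ => measurable_const) n hF]
    have h2 : ((Fin.snocEquiv fun _ : Fin (n + 1) => ℤˣ) (u, s)) = Fin.snoc s u := rfl
    rw [h2, alphaSeq_snoc_last]
    congr 1
    exact volLaw_congr n fun t ht => by rw [alphaSeq_snoc_of_lt α lam s u ht]

lemma volLaw_alphaOf (ω β α lam v : ℝ) (n : ℕ) :
    volLaw ω β (fun _ => alphaOf α lam) v (n + 1) = (2⁻¹ : ℝ≥0∞) ^ (n + 1) •
      ∑ s : Signs (n + 2), volLaw ω β (fun t _ => alphaSign α lam s (t + 1)) v (n + 1) := by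
  ext B hB
  have h := lintegral_volLaw_alphaOf ω β α lam v (n + 1) (measurable_one.indicator hB)
  simp only [lintegral_indicator_one hB] at h
  rw [h, Measure.smul_apply, Measure.finsetSum_apply, smul_eq_mul]
  congr 1
  -- Steps are counted from 0 and signs from 1.
  let e : Fin (n + 1) ≃ Finset.Icc 1 (n + 2 - 1) :=
    { toFun := fun i => ⟨i + 1, by simp; omega⟩
      invFun := fun i => ⟨i - 1, by have := i.2; simp only [Finset.mem_Icc] at this; omega⟩
      left_inv := fun i => by simp
      right_inv := fun i => by
        have := i.2
        simp only [Finset.mem_Icc] at this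
        ext
        simp
        omega }
  rw [← (Equiv.arrowCongr e (Equiv.refl ℤˣ)).sum_comp]
  refine Finset.sum_congr rfl fun s _ => ?_
  congr 1
  refine volLaw_congr _ fun t ht => ?_
  ext _
  rw [alphaSeq, dif_pos ht, alphaSign, dif_pos (by simp; omega), alphaUnit]
  rfl

/-- The negative moments of the squared volatility after at least one step are finite. -/
lemma integrable_rpow_volLaw {ω β v : ℝ} {a : ℕ → ℝ → ℝ} (ha : ∀ n, Measurable (a n))
    (ha0 : ∀ n e, 0 ≤ a n e) (hω : 0 < ω) (hβ : 0 < β) (hv : 0 < v) (n : ℕ) {r : ℝ} (hr : 0 ≤ r) :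
    Integrable (fun w => w ^ (-r)) (volLaw ω β a v (n + 1)) := by
  have := isProbabilityMeasure_volLaw (ω := ω) (β := β) (v := v) ha (n + 1)
  refine Integrable.of_bound (by fun_prop : Measurable fun w : ℝ => w ^ (-r)).aestronglyMeasurable
    (ω ^ (-r)) ?_
  filter_upwards [ae_volLaw_ge ha ha0 hω hβ hv n] with w hw
  rw [Real.norm_of_nonneg (Real.rpow_nonneg (hω.le.trans hw) _)]
  exact Real.rpow_le_rpow_of_nonpos hω hw (by linarith)

/-- The weight 2^{-h+1} in c_j is the probability of a sign pattern, so the sum over s reassembles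
one moment under the true law. -/
theorem coeff_eq_integral {ω α β lam v : ℝ} (hω : 0 < ω) (hα : 0 < α) (hβ : 0 < β)
    (hlam : 0 ≤ lam) (hv : 0 < v) {n : ℕ}
    (hn : ∀ m, m < n → ω < β * volLower ω β v (m + 1)) {j : ℝ} (hj : 0 ≤ j) :
    coeff ω α β lam v (n + 2) j = (2 * Real.pi) ^ (((n : ℝ) + 1) / 2) *
      ∫ w, w ^ (-(1 / 2 + j)) ∂volLaw ω β (fun _ => alphaOf α lam) v (n + 1) := by
  have hi : ∀ s : Signs (n + 2), Integrable (fun w : ℝ => w ^ (-(1 / 2 + j)))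
      (volLaw ω β (fun t _ => alphaSign α lam s (t + 1)) v (n + 1)) := fun s =>
    integrable_rpow_volLaw (fun _ => measurable_const) (fun t _ => alphaSign_nonneg hα hlam s t)
      hω hβ hv n (by positivity)
  have hp : (2 : ℝ) ^ (-((n + 2 : ℕ) : ℝ) + 1) = (2⁻¹) ^ (n + 1) := by
    rw [inv_pow, ← Real.rpow_natCast, ← Real.rpow_neg (by norm_num)]
    congr 1
    push_cast
    ring
  rw [coeff, volLaw_alphaOf, integral_smul_measure, integral_finsetSum_measure fun s _ => hi s, hp]
  simp only [(coeffSign_eq_volMoment hω hα hβ hlam hv hn hj _).2, ← Finset.mul_sum, volMoment]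
  simp
  ring

/-- The law of the squared volatility after `n` steps started at `v`. -/
noncomputable abbrev garchLaw (ω α β lam v : ℝ) (n : ℕ) : Measure ℝ :=
  volLaw ω β (fun _ => alphaOf α lam) v n

instance (ω α β lam v : ℝ) (n : ℕ) : IsProbabilityMeasure (garchLaw ω α β lam v n) :=
  isProbabilityMeasure_volLaw (fun _ => measurable_alphaOf α lam) n

/-! ### The density of x_h as a Gaussian mixture -/

section series

variable {ω α β lam v : ℝ} {n : ℕ}

lemma ae_garchLaw_ge (hω : 0 < ω) (hα : 0 < α) (hβ : 0 < β) (hlam : 0 ≤ lam) (hv : 0 < v) :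
    ∀ᵐ w ∂garchLaw ω α β lam v (n + 1), ω ≤ w :=
  ae_volLaw_ge (fun _ => measurable_alphaOf α lam) (fun _ => alphaOf_nonneg hα hlam) hω hβ hv n

/-- The power series of the Gaussian density as a function of the argument. -/
lemma hasSum_rpow_mul_exp {w : ℝ} (hw : 0 < w) (u : ℝ) :
    HasSum (fun j : ℕ => (-2 : ℝ) ^ (-(j : ℤ)) / (j.factorial : ℝ) * u ^ (2 * j) *
      w ^ (-(1 / 2 + (j : ℝ)))) (w ^ (-1 / 2 : ℝ) * Real.exp (-(u ^ 2 / (2 * w)))) := by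
  have h := (NormedSpace.expSeries_div_hasSum_exp (-(u ^ 2 / (2 * w)))).mul_left
    (w ^ (-1 / 2 : ℝ))
  rw [← Real.exp_eq_exp_ℝ] at h
  refine h.congr_fun fun j => ?_
  rw [neg_add, Real.rpow_add hw, Real.rpow_neg hw.le (j : ℝ), Real.rpow_natCast, zpow_neg,
    zpow_natCast, pow_mul, show -(u ^ 2 / (2 * w)) = u ^ 2 * ((-2)⁻¹ * w⁻¹) by
      field_simp, mul_pow, mul_pow, inv_pow, inv_pow, show -(1 / 2 : ℝ) = -1 / 2 by norm_num]
  ring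

/-- The series for the density of `x_h` is a mixture of Gaussian densities. -/
lemma hasSum_termX (hω : 0 < ω) (hα : 0 < α) (hβ : 0 < β) (hlam : 0 ≤ lam) (hv : 0 < v)
    (hn : ∀ m, m < n → ω < β * volLower ω β v (m + 1)) (u : ℝ) :
    HasSum (termX ω α β lam v (n + 2) u) ((2 * Real.pi) ^ (((n : ℝ) + 1) / 2) *
      ∫ w, w ^ (-1 / 2 : ℝ) * Real.exp (-(u ^ 2 / (2 * w))) ∂garchLaw ω α β lam v (n + 1)) := by
  have key : HasSum (fun j : ℕ => ∫ w, (-2 : ℝ) ^ (-(j : ℤ)) / (j.factorial : ℝ) * u ^ (2 * j) *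
      w ^ (-(1 / 2 + (j : ℝ))) ∂garchLaw ω α β lam v (n + 1))
      (∫ w, w ^ (-1 / 2 : ℝ) * Real.exp (-(u ^ 2 / (2 * w))) ∂garchLaw ω α β lam v (n + 1)) := by
    -- Since w ≥ ω and the exponents are negative, the terms are dominated by their values at w = ω,
    -- an absolutely convergent exponential series.
    refine hasSum_integral_of_dominated_convergence
      (fun j _ => |(-2 : ℝ) ^ (-(j : ℤ)) / (j.factorial : ℝ) * u ^ (2 * j) *
        ω ^ (-(1 / 2 + (j : ℝ)))|) ?_ ?_ ?_ ?_ ?_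
    · intro j
      exact (by fun_prop : Measurable fun w : ℝ => (-2 : ℝ) ^ (-(j : ℤ)) / (j.factorial : ℝ) *
        u ^ (2 * j) * w ^ (-(1 / 2 + (j : ℝ)))).aestronglyMeasurable
    · intro j
      filter_upwards [ae_garchLaw_ge hω hα hβ hlam hv] with w hw
      rw [Real.norm_eq_abs, abs_mul, abs_mul _ (ω ^ _)]
      refine mul_le_mul_of_nonneg_left ?_ (abs_nonneg _)
      rw [abs_of_nonneg (Real.rpow_nonneg hω.le _), abs_of_nonneg
        (Real.rpow_nonneg (hω.le.trans hw) _)]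
      refine Real.rpow_le_rpow_of_nonpos hω hw ?_
      have : (0 : ℝ) ≤ j := j.cast_nonneg
      linarith
    · exact ae_of_all _ fun _ => (hasSum_rpow_mul_exp hω u).summable.abs
    · exact integrable_const _
    · filter_upwards [ae_garchLaw_ge hω hα hβ hlam hv] with w hw
      exact hasSum_rpow_mul_exp (hω.trans_le hw) u
  refine (key.mul_left ((2 * Real.pi) ^ (((n : ℝ) + 1) / 2))).congr_fun fun j => ?_
  rw [termX, coeff_eq_integral hω hα hβ hlam hv hn j.cast_nonneg, integral_const_mul]
  ring

lemma coeff_pos (hω : 0 < ω) (hα : 0 < α) (hβ : 0 < β) (hlam : 0 ≤ lam) (hv : 0 < v)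
    (hn : ∀ m, m < n → ω < β * volLower ω β v (m + 1)) (j : ℕ) :
    0 < coeff ω α β lam v (n + 2) j := by
  rw [coeff_eq_integral hω hα hβ hlam hv hn j.cast_nonneg]
  have hpi := Real.pi_pos
  refine mul_pos (by positivity) ?_
  have hae := ae_garchLaw_ge (n := n) hω hα hβ hlam hv
  have hp : ∀ᵐ w ∂garchLaw ω α β lam v (n + 1), 0 < w ^ (-(1 / 2 + (j : ℝ))) := by
    filter_upwards [hae] with w hw using Real.rpow_pos_of_pos (hω.trans_le hw) _
  rw [integral_pos_iff_support_of_nonneg_ae (hp.mono fun w hw => hw.le)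
    (integrable_rpow_volLaw (fun _ => measurable_alphaOf α lam) (fun _ => alphaOf_nonneg hα hlam)
      hω hβ hv n (by positivity))]
  have hsupp : Function.support (fun w : ℝ => w ^ (-(1 / 2 + (j : ℝ))))
      =ᵐ[garchLaw ω α β lam v (n + 1)] Set.univ :=
    Filter.eventuallyEq_univ.2 (hp.mono fun w hw => Function.mem_support.2 (ne_of_gt hw))
  rw [measure_congr hsupp]
  simp

lemma gaussianPDFReal_toNNReal {w : ℝ} (hw : 0 < w) (u : ℝ) :
    gaussianPDFReal 0 w.toNNReal u = (2 * Real.pi) ^ (-1 / 2 : ℝ) *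
      (w ^ (-1 / 2 : ℝ) * Real.exp (-(u ^ 2 / (2 * w)))) := by
  rw [gaussianPDFReal, Real.coe_toNNReal _ hw.le, Real.sqrt_eq_rpow,
    ← Real.rpow_neg (by positivity), Real.mul_rpow (by positivity) hw.le, sub_zero, neg_div,
    neg_div, mul_assoc]

lemma measurable_gaussianPDFReal_toNNReal :
    Measurable fun q : ℝ × ℝ => gaussianPDFReal 0 q.1.toNNReal q.2 := by
  unfold gaussianPDFReal
  fun_prop

/-- The constants combine to (2π)^{-h/2} (2π)^{(h-1)/2} = (2π)^{-1/2}. Nonnegativity and total mass,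
invisible in the alternating series, are read off this form. -/
theorem densityX_eq_integral (hω : 0 < ω) (hα : 0 < α) (hβ : 0 < β) (hlam : 0 ≤ lam) (hv : 0 < v)
    (hn : ∀ m, m < n → ω < β * volLower ω β v (m + 1)) (u : ℝ) :
    densityX ω α β lam v (n + 2) u =
      ∫ w, gaussianPDFReal 0 w.toNNReal u ∂garchLaw ω α β lam v (n + 1) := by
  rw [densityX, (hasSum_termX hω hα hβ hlam hv hn u).tsum_eq, ← mul_assoc,
    ← Real.rpow_add (by positivity), ← integral_const_mul]
  refine integral_congr_ae ?_
  filter_upwards [ae_garchLaw_ge hω hα hβ hlam hv] with w hw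
  rw [gaussianPDFReal_toNNReal (hω.trans_le hw)]
  congr 2
  push_cast
  ring

lemma densityX_nonneg (hω : 0 < ω) (hα : 0 < α) (hβ : 0 < β) (hlam : 0 ≤ lam) (hv : 0 < v)
    (hn : ∀ m, m < n → ω < β * volLower ω β v (m + 1)) (u : ℝ) :
    0 ≤ densityX ω α β lam v (n + 2) u := by
  rw [densityX_eq_integral hω hα hβ hlam hv hn]
  exact integral_nonneg fun w => gaussianPDFReal_nonneg _ _ _

lemma ofReal_densityX (hω : 0 < ω) (hα : 0 < α) (hβ : 0 < β) (hlam : 0 ≤ lam) (hv : 0 < v)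
    (hn : ∀ m, m < n → ω < β * volLower ω β v (m + 1)) (u : ℝ) :
    ENNReal.ofReal (densityX ω α β lam v (n + 2) u) =
      ∫⁻ w, gaussianPDF 0 w.toNNReal u ∂garchLaw ω α β lam v (n + 1) := by
  rw [densityX_eq_integral hω hα hβ hlam hv hn]
  refine ofReal_integral_eq_lintegral_ofReal ?_ (ae_of_all _ fun w => gaussianPDFReal_nonneg _ _ _)
  have hi := integrable_rpow_volLaw (v := v) (fun _ => measurable_alphaOf α lam)
    (fun _ => alphaOf_nonneg hα hlam) hω hβ hv n (r := 1 / 2) (by norm_num)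
  refine (hi.const_mul ((2 * Real.pi) ^ (-1 / 2 : ℝ))).mono'
    (measurable_gaussianPDFReal_toNNReal.comp measurable_prodMk_right).aestronglyMeasurable ?_
  filter_upwards [ae_garchLaw_ge hω hα hβ hlam hv] with w hw
  have hw0 := hω.trans_le hw
  rw [Real.norm_of_nonneg (gaussianPDFReal_nonneg _ _ _), gaussianPDFReal_toNNReal hw0, neg_div]
  refine mul_le_mul_of_nonneg_left ?_ (by positivity)
  refine mul_le_of_le_one_right (by positivity) (Real.exp_le_one_iff.2 ?_)
  rw [neg_nonpos]
  positivity

lemma gaussianReal_sqrt_mul {w : ℝ} (hw : 0 < w) {B : Set ℝ} (hB : MeasurableSet B) :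
    gaussianReal 0 1 {e | √w * e ∈ B} = ∫⁻ u in B, gaussianPDF 0 w.toNNReal u := by
  rw [← gaussianReal_apply 0 (by simpa using hw)]
  have h := gaussianReal_map_const_mul (μ := 0) (v := 1) √w
  have e : (NNReal.mk (√w ^ 2) (sq_nonneg _)) * 1 = w.toNNReal := by
    ext
    simp [Real.sq_sqrt hw.le, hw.le]
  rw [e, mul_zero] at h
  rw [← h, Measure.map_apply (by fun_prop) hB]
  rfl

/-- Tonelli, with the integral over u done first; the result has the shape of the conditional law in
`IsGarch.condExp_indicator`. -/
lemma setLIntegral_densityX (hω : 0 < ω) (hα : 0 < α) (hβ : 0 < β) (hlam : 0 ≤ lam) (hv : 0 < v)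
    (hn : ∀ m, m < n → ω < β * volLower ω β v (m + 1)) {B : Set ℝ} (hB : MeasurableSet B) :
    ∫⁻ u in B, ENNReal.ofReal (densityX ω α β lam v (n + 2) u) =
      ∫⁻ w, gaussianReal 0 1 {e | √w * e ∈ B} ∂garchLaw ω α β lam v (n + 1) := by
  simp_rw [ofReal_densityX hω hα hβ hlam hv hn]
  rw [lintegral_lintegral_swap]
  · refine lintegral_congr_ae ?_
    filter_upwards [ae_garchLaw_ge hω hα hβ hlam hv] with w hw
    exact (gaussianReal_sqrt_mul (hω.trans_le hw) hB).symm
  · exact (measurable_gaussianPDFReal_toNNReal.comp measurable_swap).ennreal_ofReal.aemeasurable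

lemma measurable_densityX (hω : 0 < ω) (hα : 0 < α) (hβ : 0 < β) (hlam : 0 ≤ lam) (hv : 0 < v)
    (hn : ∀ m, m < n → ω < β * volLower ω β v (m + 1)) :
    Measurable (densityX ω α β lam v (n + 2)) := by
  have h : Measurable fun u =>
      (∫⁻ w, gaussianPDF 0 w.toNNReal u ∂garchLaw ω α β lam v (n + 1)).toReal :=
    (Measurable.lintegral_prod_right' (f := fun q : ℝ × ℝ => gaussianPDF 0 q.2.toNNReal q.1)
      (measurable_gaussianPDFReal_toNNReal.comp measurable_swap).ennreal_ofReal).ennreal_toReal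
  convert h using 2 with u
  rw [← ofReal_densityX hω hα hβ hlam hv hn,
    ENNReal.toReal_ofReal (densityX_nonneg hω hα hβ hlam hv hn u)]

end series

/-! ### Passing from x_h to its square -/

section square

lemma termZ_eq (ω α β lam v : ℝ) (h : ℕ) {w : ℝ} (hw : 0 < w) (j : ℕ) :
    termZ ω α β lam v h w j = (√w)⁻¹ * termX ω α β lam v h √w j := by
  rw [termZ, termX, pow_mul, Real.sq_sqrt hw.le, Real.rpow_sub hw, Real.rpow_natCast,
    ← Real.sqrt_eq_rpow]
  ring

lemma densityZ_of_pos (ω α β lam v : ℝ) (h : ℕ) {w : ℝ} (hw : 0 < w) :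
    densityZ ω α β lam v h w = (√w)⁻¹ * densityX ω α β lam v h √w := by
  simp only [densityZ, densityX, if_pos hw, termZ_eq ω α β lam v h hw, tsum_mul_left]
  ring

lemma densityX_abs (ω α β lam v : ℝ) (h : ℕ) (u : ℝ) :
    densityX ω α β lam v h |u| = densityX ω α β lam v h u := by
  simp only [densityX, termX, pow_mul, sq_abs]

lemma densityX_eq_densityZ (ω α β lam v : ℝ) (h : ℕ) {u : ℝ} (hu : u ≠ 0) :
    densityX ω α β lam v h u = densityZ ω α β lam v h (u ^ 2) * |u| := by
  rw [densityZ_of_pos ω α β lam v h (by positivity), Real.sqrt_sq_eq_abs, densityX_abs]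
  field_simp [abs_ne_zero.2 hu]

lemma measurable_densityZ {ω α β lam v : ℝ} {h : ℕ} (hX : Measurable (densityX ω α β lam v h)) :
    Measurable (densityZ ω α β lam v h) := by
  have : densityZ ω α β lam v h = (Set.Ioi 0).indicator
      fun w => (√w)⁻¹ * densityX ω α β lam v h √w := by
    ext w
    by_cases hw : 0 < w
    · rw [densityZ_of_pos ω α β lam v h hw, Set.indicator_of_mem (Set.mem_Ioi.2 hw)]
    · rw [densityZ, if_neg hw, Set.indicator_of_notMem (by simpa using hw)]
  rw [this]
  exact Measurable.indicator (by fun_prop) measurableSet_Ioi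

lemma lintegral_eq_two_mul_of_even {H : ℝ → ℝ≥0∞} (hH : Measurable H)
    (heven : ∀ u, H (-u) = H u) : ∫⁻ u, H u = 2 * ∫⁻ u in Set.Ioi 0, H u := by
  rw [← lintegral_add_compl _ (measurableSet_Ioi (a := (0 : ℝ))), two_mul, Set.compl_Ioi,
    setLIntegral_congr Iio_ae_eq_Iic.symm]
  congr 1
  have h := (Measure.measurePreserving_neg (volume : Measure ℝ)).setLIntegral_comp_preimage
    (measurableSet_Ioi (a := (0 : ℝ))) hH
  simpa [heven] using h

/-- The series for the density of `z_h` is that of the square of a variable with density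
`densityX`. -/
lemma setLIntegral_densityZ {ω α β lam v : ℝ} {h : ℕ} (hX : Measurable (densityX ω α β lam v h))
    {B : Set ℝ} (hB : MeasurableSet B) :
    ∫⁻ w in B, ENNReal.ofReal (densityZ ω α β lam v h w) =
      ∫⁻ u in (fun u => u ^ 2) ⁻¹' B, ENNReal.ofReal (densityX ω α β lam v h u) := by
  have hsq : Measurable fun u : ℝ => u ^ 2 := by fun_prop
  have hB' : MeasurableSet ((fun u : ℝ => u ^ 2) ⁻¹' B) := hsq hB
  set H := ((fun u : ℝ => u ^ 2) ⁻¹' B).indicator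
    fun u => ENNReal.ofReal (densityX ω α β lam v h u) with hH
  set g := B.indicator fun w => ENNReal.ofReal (densityZ ω α β lam v h w) with hg
  have hHm : Measurable H := hX.ennreal_ofReal.indicator hB'
  have himg : (fun u : ℝ => u ^ 2) '' Set.Ioi 0 = Set.Ioi 0 := by
    ext w
    refine ⟨?_, fun hw => ⟨√w, Real.sqrt_pos.2 hw, Real.sq_sqrt (le_of_lt hw)⟩⟩
    rintro ⟨u, hu, rfl⟩
    exact pow_pos (Set.mem_Ioi.1 hu) 2
  -- The Jacobian 2u of w = u² supplies both the factor |u| between the densities and the 2 from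
  -- folding the line onto the half-line.
  have hch := lintegral_image_eq_lintegral_abs_deriv_mul (s := Set.Ioi 0)
    (f := fun u : ℝ => u ^ 2) (f' := fun u => 2 * u) measurableSet_Ioi
    (fun u _ => by simpa using (hasDerivAt_pow 2 u).hasDerivWithinAt)
    (fun u hu u' hu' huu => (pow_left_inj₀ (le_of_lt hu) (le_of_lt hu') two_ne_zero).1 huu) g
  rw [himg] at hch
  rw [← lintegral_indicator hB', ← lintegral_indicator hB, lintegral_eq_two_mul_of_even hHm]
  · rw [← lintegral_const_mul _ hHm]
    change ∫⁻ w, g w = _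
    have hg0 : ∫⁻ w, g w = ∫⁻ w in Set.Ioi 0, g w := by
      rw [← lintegral_indicator measurableSet_Ioi]
      congr 1
      ext w
      by_cases hw : 0 < w
      · rw [Set.indicator_of_mem (Set.mem_Ioi.2 hw)]
      · rw [Set.indicator_of_notMem (by simpa using hw)]
        simp [hg, densityZ, hw, Set.indicator]
    rw [hg0, hch]
    refine setLIntegral_congr_fun measurableSet_Ioi fun u hu => ?_
    have hu : 0 < u := hu
    by_cases hb : u ^ 2 ∈ B
    · simp only [hH, hg, Set.indicator_of_mem hb,
        Set.indicator_of_mem (s := (fun u : ℝ => u ^ 2) ⁻¹' B) hb]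
      rw [densityX_eq_densityZ ω α β lam v h hu.ne', abs_of_pos (by positivity), abs_of_pos hu,
        ENNReal.ofReal_mul' hu.le, ENNReal.ofReal_mul' hu.le, ENNReal.ofReal_ofNat]
      ring
    · simp only [hH, hg, Set.indicator_of_notMem hb,
        Set.indicator_of_notMem (s := (fun u : ℝ => u ^ 2) ⁻¹' B) hb, mul_zero]
  · intro u
    have h1 : densityX ω α β lam v h (-u) = densityX ω α β lam v h u := by
      rw [← densityX_abs, abs_neg, densityX_abs]
    by_cases hb : u ^ 2 ∈ B <;> simp [hH, hb, h1]

end square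

/-! ### Conditioning by freezing an F₀-measurable variable -/

section freezing

variable {Ω E : Type*} {F₀ mΩ : MeasurableSpace Ω} [MeasurableSpace E] {μ : Measure Ω}
  [IsProbabilityMeasure μ] {V : Ω → ℝ} {Y : Ω → E}

/-- Integrating out a random variable that is independent of `F₀`. -/
lemma setLIntegral_of_indep (hle : F₀ ≤ mΩ) (hV : Measurable[F₀] V) (hY : Measurable Y)
    (hind : Indep F₀ (MeasurableSpace.comap Y inferInstance) μ) {g : ℝ × E → ℝ≥0∞}
    (hg : Measurable g) {A : Set Ω} (hA : MeasurableSet[F₀] A) :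
    ∫⁻ p in A, g (V p, Y p) ∂μ = ∫⁻ p in A, ∫⁻ y, g (V p, y) ∂μ.map Y ∂μ := by
  have hprob : IsProbabilityMeasure (μ.map Y) := Measure.isProbabilityMeasure_map hY.aemeasurable
  -- Carrying the indicator of A along with V turns the integral over A into one against a joint
  -- law, which is a product by independence.
  have hW : Measurable[F₀] fun p => (V p, A.indicator (fun _ => (1 : ℝ≥0∞)) p) :=
    hV.prodMk (measurable_const.indicator hA)
  have hWm := hW.mono hle le_rfl
  have hi : IndepFun (fun p => (V p, A.indicator (fun _ => (1 : ℝ≥0∞)) p)) Y μ :=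
    indep_of_indep_of_le_left hind hW.comap_le
  have hmap := (indepFun_iff_map_prod_eq_prod_map_map hWm.aemeasurable hY.aemeasurable).1 hi
  have hG : Measurable fun q : (ℝ × ℝ≥0∞) × E => q.1.2 * g (q.1.1, q.2) := by fun_prop
  have h1 : ∫⁻ p in A, g (V p, Y p) ∂μ =
      ∫⁻ q, q.1.2 * g (q.1.1, q.2)
        ∂μ.map fun p => ((V p, A.indicator (fun _ => (1 : ℝ≥0∞)) p), Y p) := by
    rw [lintegral_map hG (hWm.prodMk hY), ← lintegral_indicator (hle _ hA)]
    congr 1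
    ext p
    by_cases hp : p ∈ A <;> simp [hp]
  rw [h1, hmap, lintegral_prod _ hG.aemeasurable, lintegral_map hG.lintegral_prod_right' hWm,
    ← lintegral_indicator (hle _ hA)]
  congr 1
  ext p
  by_cases hp : p ∈ A <;> simp [hp]

/-- The conditional law, given `F₀`, of a function of an `F₀`-measurable random variable and of one
that is independent of `F₀`. -/
lemma condExp_indicator_of_indep (hle : F₀ ≤ mΩ) (hV : Measurable[F₀] V) (hY : Measurable Y)
    (hind : Indep F₀ (MeasurableSpace.comap Y inferInstance) μ) {G : ℝ × E → ℝ} (hG : Measurable G)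
    {B : Set ℝ} (hB : MeasurableSet B) :
    μ[((fun p => G (V p, Y p)) ⁻¹' B).indicator (fun _ => (1 : ℝ)) | F₀] =ᵐ[μ]
      fun p => (μ.map Y {y | G (V p, y) ∈ B}).toReal := by
  have hprob : IsProbabilityMeasure (μ.map Y) := Measure.isProbabilityMeasure_map hY.aemeasurable
  have hVm := hV.mono hle le_rfl
  have hset : MeasurableSet {q : ℝ × E | G q ∈ B} := hG hB
  have hφ : Measurable fun v => μ.map Y {y | G (v, y) ∈ B} := measurable_measure_prodMk_left hset
  have hX : MeasurableSet ((fun p => G (V p, Y p)) ⁻¹' B) := (hG.comp (hVm.prodMk hY)) hB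
  have hm : Measurable fun p => μ.map Y {y | G (V p, y) ∈ B} := hφ.comp hVm
  have hbd : ∀ v, μ.map Y {y | G (v, y) ∈ B} < ∞ := fun v => measure_lt_top _ _
  symm
  refine ae_eq_condExp_of_forall_setIntegral_eq hle ((integrable_const _).indicator hX)
    (fun A _ _ => ?_) (fun A hA _ => ?_)
    (hφ.comp hV).ennreal_toReal.stronglyMeasurable.aestronglyMeasurable
  · refine (Integrable.of_bound hm.ennreal_toReal.aestronglyMeasurable 1
      (ae_of_all _ fun p => ?_)).integrableOn
    rw [Real.norm_of_nonneg ENNReal.toReal_nonneg]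
    exact ENNReal.toReal_le_of_le_ofReal zero_le_one (by simpa using prob_le_one)
  · rw [integral_toReal hm.aemeasurable (ae_of_all _ fun p => hbd _), setIntegral_indicator hX,
      setIntegral_const, smul_eq_mul, mul_one, Measure.real]
    congr 1
    have h := setLIntegral_of_indep hle hV hY hind (measurable_one.indicator hset) hA
      (g := {q : ℝ × E | G q ∈ B}.indicator 1)
    have e1 : ∀ p, ∫⁻ y, ({q : ℝ × E | G q ∈ B}.indicator 1 (V p, y) : ℝ≥0∞) ∂μ.map Y =
        μ.map Y {y | G (V p, y) ∈ B} := fun p => by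
      exact lintegral_indicator_one (measurable_prodMk_left hset : MeasurableSet
        (Prod.mk (V p) ⁻¹' {q : ℝ × E | G q ∈ B}))
    simp_rw [e1] at h
    rw [← h, Set.inter_comm, ← Measure.restrict_apply hX, ← lintegral_indicator_one hX]
    rfl

end freezing

/-! ### The squared volatility as a function of the innovations -/

section path

/-- The squared volatility after `n` steps as a function of its initial value and the
innovations. -/
noncomputable def volPath (ω α β lam v : ℝ) : (n : ℕ) → (Fin n → ℝ) → ℝ
  | 0, _ => v
  | n + 1, e => ω + (β + alphaOf α lam (e (Fin.last n)) * e (Fin.last n) ^ 2) *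
      volPath ω α β lam v n (Fin.init e)

variable {ω α β lam : ℝ}

lemma measurable_volPath (n : ℕ) :
    Measurable fun q : ℝ × (Fin n → ℝ) => volPath ω α β lam q.1 n q.2 := by
  induction n with
  | zero => exact measurable_fst
  | succ n ih =>
    have h1 : Measurable fun q : ℝ × (Fin (n + 1) → ℝ) => (q.1, (Fin.init q.2 : Fin n → ℝ)) :=
      measurable_fst.prodMk (measurable_pi_lambda _ fun i =>
        (measurable_pi_apply (Fin.castSucc i)).comp measurable_snd)
    have h2 : Measurable fun q : ℝ × (Fin (n + 1) → ℝ) => q.2 (Fin.last n) := by fun_prop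
    have h3 := ih.comp h1
    have h4 := (measurable_alphaOf α lam).comp h2
    exact measurable_const.add (((measurable_const.add (h4.mul (h2.pow_const 2)))).mul h3)

/-- `volLaw` and `volPath` both add the newest innovation at the end, so the product measure is
split at its last coordinate. -/
lemma map_init_last (n : ℕ) :
    (Measure.pi fun _ : Fin (n + 1) => gaussianReal 0 1).map
      (fun e => ((Fin.init e : Fin n → ℝ), e (Fin.last n))) =
    (Measure.pi fun _ : Fin n => gaussianReal 0 1).prod (gaussianReal 0 1) := by
  have h := (measurePreserving_piFinSuccAbove (fun _ : Fin (n + 1) => gaussianReal 0 1)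
    (Fin.last n)).map_eq
  rw [← Measure.prod_swap, ← h, Measure.map_map measurable_swap (MeasurableEquiv.measurable _)]
  congr 1
  ext e i
  · simp [MeasurableEquiv.piFinSuccAbove_apply, Fin.insertNthEquiv]
  · simp [MeasurableEquiv.piFinSuccAbove_apply, Fin.insertNthEquiv]

lemma measurable_init_last (n : ℕ) :
    Measurable fun e : Fin (n + 1) → ℝ => ((Fin.init e : Fin n → ℝ), e (Fin.last n)) :=
  (measurable_pi_lambda _ fun i => measurable_pi_apply (Fin.castSucc i)).prodMk
    (measurable_pi_apply _)

lemma map_volPath (v : ℝ) (n : ℕ) :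
    (Measure.pi fun _ : Fin n => gaussianReal 0 1).map (volPath ω α β lam v n) =
      garchLaw ω α β lam v n := by
  induction n with
  | zero =>
    have : volPath ω α β lam v 0 = fun _ => v := rfl
    rw [this, Measure.map_const]
    simp [garchLaw, volLaw]
  | succ n ih =>
    have hm : Measurable (volPath ω α β lam v n) :=
      (measurable_volPath n).comp measurable_prodMk_left
    have hs := measurable_volStep (ω := ω) (β := β) (fun _ => measurable_alphaOf α lam) n
    have hprod := Measure.map_prod_map (Measure.pi fun _ : Fin n => gaussianReal 0 1)
      (gaussianReal 0 1) hm measurable_id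
    rw [Measure.map_id] at hprod
    rw [garchLaw, volLaw, ← garchLaw, ← ih, hprod, ← map_init_last,
      Measure.map_map (hm.prodMap measurable_id) (measurable_init_last n),
      Measure.map_map hs ((hm.prodMap measurable_id).comp (measurable_init_last n))]
    rfl

/-- The law of the next observation after `n` steps. -/
lemma pi_volPath_mul (v : ℝ) (n : ℕ) {B : Set ℝ} (hB : MeasurableSet B) :
    (Measure.pi fun _ : Fin (n + 1) => gaussianReal 0 1)
      {e | √(volPath ω α β lam v n (Fin.init e)) * e (Fin.last n) ∈ B} =
    ∫⁻ w, gaussianReal 0 1 {e | √w * e ∈ B} ∂garchLaw ω α β lam v n := by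
  have hm : Measurable (volPath ω α β lam v n) :=
    (measurable_volPath n).comp measurable_prodMk_left
  have hset : MeasurableSet {q : ℝ × ℝ | √q.1 * q.2 ∈ B} :=
    (by fun_prop : Measurable fun q : ℝ × ℝ => √q.1 * q.2) hB
  have hset' : MeasurableSet {q : (Fin n → ℝ) × ℝ | √(volPath ω α β lam v n q.1) * q.2 ∈ B} :=
    (by fun_prop : Measurable fun q : (Fin n → ℝ) × ℝ => √(volPath ω α β lam v n q.1) * q.2) hB
  have h1 : {e : Fin (n + 1) → ℝ | √(volPath ω α β lam v n (Fin.init e)) * e (Fin.last n) ∈ B} =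
      (fun e => ((Fin.init e : Fin n → ℝ), e (Fin.last n))) ⁻¹'
        {q : (Fin n → ℝ) × ℝ | √(volPath ω α β lam v n q.1) * q.2 ∈ B} := rfl
  rw [h1, ← Measure.map_apply (measurable_init_last n) hset', map_init_last,
    Measure.prod_apply hset', ← map_volPath]
  exact (lintegral_map (f := fun w => gaussianReal 0 1 {e | √w * e ∈ B})
    (measurable_measure_prodMk_left hset) hm).symm

end path

/-! ### The conditional law of the process -/

section process

variable {Ω : Type*} {F₀ mΩ : MeasurableSpace Ω} {μ : Measure Ω} {ω α β lam : ℝ}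
  {ε x σ : ℕ → Ω → ℝ}

lemma IsGarch.sigma_sq_eq (hG : IsGarch F₀ μ ω α β lam ε x σ) (n : ℕ) (p : Ω) :
    σ (n + 1) p ^ 2 = volPath ω α β lam (σ 1 p ^ 2) n (fun t => ε (t + 1) p) := by
  induction n with
  | zero => rfl
  | succ n ih =>
    have hpos := hG.sigma_pos (n + 1) p
    -- Positive volatility gives x and its innovation the same sign, so the recursion sees only the
    -- innovations.
    have hsign : alphaOf α lam (x (n + 1) p) = alphaOf α lam (ε (n + 1) p) := by
      simp only [alphaOf, hG.x_eq n p, mul_neg_iff, hpos, not_lt_of_gt hpos, true_and, false_and,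
        or_false]
    have hi : volPath ω α β lam (σ 1 p ^ 2) n
        (Fin.init (n := n) (α := fun _ => ℝ) fun t : Fin (n + 1) => ε (t + 1) p) =
        σ (n + 1) p ^ 2 := ih.symm
    rw [hG.sigma_eq (n + 1) p, hsign, volPath, hi, hG.x_eq n p]
    simp only [Fin.val_last]
    ring

lemma IsGarch.x_eq_volPath (hG : IsGarch F₀ μ ω α β lam ε x σ) (n : ℕ) (p : Ω) :
    x (n + 1) p = √(volPath ω α β lam (σ 1 p ^ 2) n
      (Fin.init (n := n) (α := fun _ => ℝ) fun t : Fin (n + 1) => ε (t + 1) p)) *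
        ε (n + 1) p := by
  have h : σ (n + 1) p ^ 2 = volPath ω α β lam (σ 1 p ^ 2) n
      (Fin.init (n := n) (α := fun _ => ℝ) fun t : Fin (n + 1) => ε (t + 1) p) :=
    hG.sigma_sq_eq n p
  rw [← h, Real.sqrt_sq (hG.sigma_pos _ _).le, hG.x_eq]

lemma IsGarch.measurable_sigma_one_sq (hG : IsGarch F₀ μ ω α β lam ε x σ) :
    Measurable[F₀] fun p => σ 1 p ^ 2 := by
  have h : (fun p => σ 1 p ^ 2) =
      fun p => ω + alphaOf α lam (x 0 p) * x 0 p ^ 2 + β * σ 0 p ^ 2 :=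
    funext (hG.sigma_eq 0)
  rw [h]
  have h1 := (measurable_alphaOf α lam).comp hG.measurable_x_zero
  exact (measurable_const.add (h1.mul (hG.measurable_x_zero.pow_const 2))).add
    (measurable_const.mul (hG.measurable_sigma_zero.pow_const 2))

/-- The conditional law of the observations given the information at time `0`. -/
theorem IsGarch.condExp_indicator [IsProbabilityMeasure μ]
    (hG : IsGarch F₀ μ ω α β lam ε x σ) (n : ℕ) {B : Set ℝ} (hB : MeasurableSet B) :
    μ[(x (n + 1) ⁻¹' B).indicator (fun _ => (1 : ℝ)) | F₀] =ᵐ[μ] fun p =>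
      (∫⁻ w, gaussianReal 0 1 {e | √w * e ∈ B} ∂garchLaw ω α β lam (σ 1 p ^ 2) n).toReal := by
  set Y : Ω → (Fin (n + 1) → ℝ) := fun p t => ε (t + 1) p
  have hY : Measurable Y := measurable_pi_lambda _ fun t => hG.measurable_eps t
  have hlaw : μ.map Y = Measure.pi fun _ => gaussianReal 0 1 := by
    have h := (iIndepFun_iff_map_fun_eq_pi_map
      (f := fun (t : Fin (n + 1)) => ε (t + 1)) fun t => (hG.measurable_eps t).aemeasurable).1
      (hG.iIndep_eps.precomp Fin.val_injective)
    simp only [hG.law_eps] at h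
    exact h
  have hind : Indep F₀ (MeasurableSpace.comap Y inferInstance) μ := by
    refine indep_of_indep_of_le_right hG.indep_past ?_
    have hr : Measurable fun (f : ℕ → ℝ) (t : Fin (n + 1)) => f t :=
      measurable_pi_lambda _ fun t => measurable_pi_apply _
    have hc : Y = (fun (f : ℕ → ℝ) (t : Fin (n + 1)) => f t) ∘ fun p t => ε (t + 1) p := rfl
    rw [hc, ← MeasurableSpace.comap_comp]
    exact MeasurableSpace.comap_mono hr.comap_le
  have hGm : Measurable fun q : ℝ × (Fin (n + 1) → ℝ) =>
      √(volPath ω α β lam q.1 n (Fin.init q.2)) * q.2 (Fin.last n) := by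
    have h1 : Measurable fun q : ℝ × (Fin (n + 1) → ℝ) => (q.1, (Fin.init q.2 : Fin n → ℝ)) :=
      measurable_fst.prodMk (measurable_pi_lambda _ fun i =>
        (measurable_pi_apply (Fin.castSucc i)).comp measurable_snd)
    have h2 := (measurable_volPath (ω := ω) (α := α) (β := β) (lam := lam) n).comp h1
    exact h2.sqrt.mul (by fun_prop)
  have hx : x (n + 1) = fun p => (fun q : ℝ × (Fin (n + 1) → ℝ) =>
      √(volPath ω α β lam q.1 n (Fin.init q.2)) * q.2 (Fin.last n)) (σ 1 p ^ 2, Y p) :=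
    funext fun p => hG.x_eq_volPath n p
  have h := condExp_indicator_of_indep hG.le hG.measurable_sigma_one_sq hY hind hGm hB
  rw [← hx] at h
  filter_upwards [h] with p hp
  rw [hp, hlaw, pi_volPath_mul _ _ hB]

end process

end GJR

theorem theorem1 {Ω : Type*} (F₀ : MeasurableSpace Ω) {mΩ : MeasurableSpace Ω}
    (μ : Measure Ω) [IsProbabilityMeasure μ] (ω α β lam : ℝ) (hω : 0 < ω) (hα : 0 < α) (hβ : 0 < β)
    (hlam : 0 ≤ lam) (ε x σ : ℕ → Ω → ℝ) (hG : GJR.IsGarch F₀ μ ω α β lam ε x σ)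
    (h : ℕ) (hh : 2 ≤ h)
    (hA : 3 ≤ h → ∀ᵐ p ∂μ, GJR.betaLower (ω / (2 * σ 1 p ^ 2)) < β)
    (hB : 3 < h → 1 / 2 ≤ β) :
    (∀ᵐ p ∂μ,
      (∀ (j : ℕ) (s : GJR.Signs h), GJR.NestedSummable (h - 2) (GJR.upper (-1 / 2 - (j : ℝ)))
        (GJR.term ω α β lam (σ 1 p ^ 2) h j s)) ∧
      (∀ j : ℕ, 0 < GJR.coeff ω α β lam (σ 1 p ^ 2) h j) ∧
      (∀ w : ℝ, 0 < w → Summable fun j => |GJR.termZ ω α β lam (σ 1 p ^ 2) h w j|) ∧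
      (∀ u : ℝ, Summable fun j => |GJR.termX ω α β lam (σ 1 p ^ 2) h u j|) ∧
      (∀ u : ℝ, u ≠ 0 → GJR.densityX ω α β lam (σ 1 p ^ 2) h u =
        GJR.densityZ ω α β lam (σ 1 p ^ 2) h (u ^ 2) * |u|)) ∧
    GJR.IsCondDensity F₀ μ (fun p => x h p ^ 2)
      (fun p w => GJR.densityZ ω α β lam (σ 1 p ^ 2) h w) ∧
    GJR.IsCondDensity F₀ μ (x h) (fun p u => GJR.densityX ω α β lam (σ 1 p ^ 2) h u) := by
  obtain ⟨n, rfl⟩ : ∃ n, h = n + 2 := ⟨h - 2, by omega⟩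
  have hv : ∀ p, 0 < σ 1 p ^ 2 := fun p => pow_pos (hG.sigma_pos 1 p) 2
  have hn : ∀ᵐ p ∂μ, ∀ m, m < n → ω < β * GJR.volLower ω β (σ 1 p ^ 2) (m + 1) := by
    -- For h = 2 nothing is expanded in ω and the condition is empty. Otherwise N = h - 2, so 1 < N
    -- means h > 3.
    rcases Nat.eq_zero_or_pos n with rfl | hpos
    · exact ae_of_all _ fun p m hm => absurd hm (by omega)
    · filter_upwards [hA (by omega)] with p hp m hm
      exact GJR.lt_mul_volLower hω hβ (hv p) hp (N := n) (fun h1 => hB (by omega)) hm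
  have hX0 : ∀ᵐ p ∂μ, ∀ u, 0 ≤ GJR.densityX ω α β lam (σ 1 p ^ 2) (n + 2) u := by
    filter_upwards [hn] with p hp u using GJR.densityX_nonneg hω hα hβ hlam (hv p) hp u
  have hXm : ∀ᵐ p ∂μ, Measurable (GJR.densityX ω α β lam (σ 1 p ^ 2) (n + 2)) := by
    filter_upwards [hn] with p hp using GJR.measurable_densityX hω hα hβ hlam (hv p) hp
  have hZ0 : ∀ᵐ p ∂μ, ∀ w, 0 ≤ GJR.densityZ ω α β lam (σ 1 p ^ 2) (n + 2) w := by
    filter_upwards [hX0] with p hp w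
    by_cases hw : 0 < w
    · rw [GJR.densityZ_of_pos _ _ _ _ _ _ hw]
      exact mul_nonneg (by positivity) (hp _)
    · rw [GJR.densityZ, if_neg hw]
  -- The total mass is an average of Gaussian total masses; it yields the integrability of both
  -- densities.
  have hX1 : ∀ᵐ p ∂μ, ∫⁻ u, ENNReal.ofReal (GJR.densityX ω α β lam (σ 1 p ^ 2) (n + 2) u) = 1 := by
    filter_upwards [hn] with p hp
    rw [← setLIntegral_univ, GJR.setLIntegral_densityX hω hα hβ hlam (hv p) hp MeasurableSet.univ]
    simp
  have hcX : ∀ B : Set ℝ, MeasurableSet B →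
      μ[(x (n + 2) ⁻¹' B).indicator (fun _ => (1 : ℝ)) | F₀] =ᵐ[μ] fun p =>
        (∫⁻ u in B, ENNReal.ofReal
          (GJR.densityX ω α β lam (σ 1 p ^ 2) (n + 2) u)).toReal := by
    intro B hB
    filter_upwards [hG.condExp_indicator (n + 1) hB, hn] with p h1 h2
    rw [h1, GJR.setLIntegral_densityX hω hα hβ hlam (hv p) h2 hB]
  refine ⟨?_, ⟨hZ0, ?_, fun B hB => ?_⟩, ⟨hX0, ?_, fun B hB => ?_⟩⟩
  · filter_upwards [hn] with p hp
    have hs := fun u => (GJR.hasSum_termX hω hα hβ hlam (hv p) hp u).summable.abs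
    refine ⟨fun j s => (GJR.coeffSign_eq_volMoment hω hα hβ hlam (hv p) hp j.cast_nonneg s).1,
      GJR.coeff_pos hω hα hβ hlam (hv p) hp, fun w hw => ?_, hs,
      fun u hu => GJR.densityX_eq_densityZ _ _ _ _ _ _ hu⟩
    simp only [GJR.termZ_eq _ _ _ _ _ _ hw, abs_mul]
    exact (hs √w).mul_left _
  · filter_upwards [hZ0, hXm, hX1] with p h0 hm h1
    refine ⟨(GJR.measurable_densityZ hm).aestronglyMeasurable, ?_⟩
    rw [hasFiniteIntegral_iff_ofReal (ae_of_all _ h0), ← setLIntegral_univ,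
      GJR.setLIntegral_densityZ hm MeasurableSet.univ, Set.preimage_univ, setLIntegral_univ, h1]
    exact ENNReal.one_lt_top
  · have hB' : MeasurableSet ((fun u : ℝ => u ^ 2) ⁻¹' B) :=
      (by fun_prop : Measurable fun u : ℝ => u ^ 2) hB
    filter_upwards [hcX _ hB', hZ0, hXm] with p h1 h0 hm
    rw [integral_eq_lintegral_of_nonneg_ae (ae_of_all _ h0)
      (GJR.measurable_densityZ hm).aestronglyMeasurable, GJR.setLIntegral_densityZ hm hB]
    exact h1
  · filter_upwards [hX0, hXm, hX1] with p h0 hm h1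
    refine ⟨hm.aestronglyMeasurable, ?_⟩
    rw [hasFiniteIntegral_iff_ofReal (ae_of_all _ h0), h1]
    exact ENNReal.one_lt_top
  · filter_upwards [hcX B hB, hX0, hXm] with p h1 h0 hm
    rw [h1, integral_eq_lintegral_of_nonneg_ae (ae_of_all _ h0) hm.aestronglyMeasurable]
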